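/- Let $\mathbb{F}_q$ be a finite field, let $\mathcal{X}$ be a rational curve over $\mathbb{F}_q$ (a nonsingular projective curve whose function field is isomorphic to $\mathbb{F}_q(x)$), let $Q$ be a rational point of $\mathcal{X}$ and let $P_1,\dots,P_l$ be distinct rational points different from $Q$; put $D=P_1+\dots+P_l$. For a divisor $A$ let $\mathcal{L}(A)=\{f : f=0 \text{ or } \operatorname{div}(f)+A\ge 0\}$ and, when the support of $A$ is disjoint from that of $D$, let $C(D,A)=\{(f(P_1),\dots,f(P_l)) : f\in\mathcal{L}(A)\}$. Let $H^*(Q)=\{m\in\mathbb{N}_0 : C(D,(m-1)Q)\ne C(D,mQ)\}$. A kernel of $(\mathcal{X},Q)$ and $D$ is an $l\times l$ matrix $G$ with rows $(M_{l-i}(P_1),\dots,M_{l-i}(P_l))$, $i=1,\dots,l$, where $M_0,\dots,M_{l-1}$ are functions with $M_k\in\mathcal{L}(m_kQ)\setminus\mathcal{L}((m_k-1)Q)$ and $m_0<\dots<m_{l-1}$ are the elements of $H^*(Q)$. A channel $W:\mathbb{F}_q\to\mathcal{O}$ with finite output alphabet $\mathcal{O}$ is given by transition probabilities $W(y|x)$.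 It is SOF (symmetric with respect to the field operations) if there are permutations $\sigma_a$ $(a\in\mathbb{F}_q)$ and $\psi_a$ $(a\in\mathbb{F}_q^*)$ of $\mathcal{O}$ such that $W(y|x)=W(\sigma_{x'-x}(y)|x')$ for all $x,x'\in\mathbb{F}_q$ and $y\in\mathcal{O}$, and $W(y|x)=W(\psi_a(y)|ax)$ for all $a\in\mathbb{F}_q^*$, $x\in\mathbb{F}_q$ and $y\in\mathcal{O}$. Its Bhattacharyya parameter is $Z(W)=\frac{1}{q(q-1)}\sum_{x\neq x'}\sum_y\sqrt{W(y|x)W(y|x')}\in[0,1]$. For $n\ge 0$ and $N=l^n$ put $G_n=B_nG^{\otimes n}$, where $B_n$ is the $l$-ary digit-reversal permutation matrix, and for $1\le i\le N$ let $W_n^{(i)}$ be the channel $$W_n^{(i)}(y_1^N,u_1^{i-1}\mid u_i)=\frac{1}{q^{N-1}}\sum_{u_{i+1}^N\in\mathbb{F}_q^{N-i}}\ \prod_{k=1}^N W\bigl(y_k\mid (u_1^NG_n)_k\bigr).$$ For $A\subseteq\{0,\dots,N-1\}$ let $C_A$ be the code generated by the rows of $G_n$ with numbers $N-k$, $k\in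 A$ (row $N-k$ is the evaluation of $M_{k_1}(X_1)\cdots M_{k_n}(X_n)$, where $k_1,\dots,k_n$ are the $l$-ary digits of $k$). The code $C_A$ is a polar code for $W$ if $Z(W_n^{(N-k)})\le Z(W_n^{(N-j)})$ for all $k\in A$ and $j\notin A$. It is weakly decreasing if $j\in A$ whenever $k\in A$ and every $l$-ary digit of $j$ is at most the corresponding digit of $k$. Then: 1. $H^*(Q)=\{0,1,\dots,l-1\}$, that is, $H^*(Q)$ has no gaps; 2. kernels $G$ of $(\mathcal{X},Q)$ and $D$ exist, and all of them are non-singular; 3. for every such kernel $G$, every SOF channel $W$ with $0<Z(W)<1$ (neither noiseless nor useless) and every $n$, every polar code $C_A$ for $W$ is weakly decreasing. -/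

import Mathlib

open scoped WithZero

noncomputable section

namespace PolarAG

/-! Places, Riemann-Roch spaces and evaluation codes of a curve over `F`, in terms of its
function field `K`. -/

/-- A place of `K / F`: a discrete valuation ring of `K` (with quotient field `K`) containing the
field of constants `F`. These are the closed points of the nonsingular projective curve with
function field `K`. -/
@[ext]
structure Place (F K : Type*) [Field F] [Field K] [Algebra F K] where
  ring : ValuationSubring K
  const_mem : ∀ c : F, algebraMap F K c ∈ ring
  isDVR : IsDiscreteValuationRing ring

namespace Place

variable {F K : Type*} [Field F] [Field K] [Algebra F K]

/-- The normalised valuation of the place, written multiplicatively: `P.val f = exp (-v_P(f))`,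
so that `P.val f ≤ 1` says that `f` is regular at `P` and `P.val f < 1` that `f` vanishes
at `P`. -/
def val (P : Place F K) : Valuation K ℤᵐ⁰ :=
  letI := P.isDVR
  (IsDiscreteValuationRing.maximalIdeal P.ring).valuation K

/-- The place is rational (of degree one): every residue class is represented by a constant. -/
def IsRational (P : Place F K) : Prop :=
  ∀ f ∈ P.ring, ∃ c : F, P.val (f - algebraMap F K c) < 1

open Classical in
/-- The value `f(P)` of a function at a rational place at which it is regular: the unique
constant `c` such that `f - c` vanishes at `P` (and `0` if there is none). -/
def eval (P : Place F K) (f : K) : F :=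
  if h : ∃ c : F, P.val (f - algebraMap F K c) < 1 then h.choose else 0

end Place

/-- The curve with function field `K` is rational: `K` is a rational function field `F(x)`. -/
def IsRationalCurve (F K : Type*) [Field F] [Field K] [Algebra F K] : Prop :=
  Nonempty (K ≃ₐ[F] RatFunc F)

section Codes

variable {F K : Type*} [Field F] [Field K] [Algebra F K]

/-- The Riemann-Roch space `L(A)` of a divisor `A` on the curve: all `f` with `f = 0` or
`div(f) + A ≥ 0`. -/
def rrSpace (A : Place F K →₀ ℤ) : Set K :=
  {f | ∀ P : Place F K, P.val f ≤ WithZero.exp (A P)}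

/-- The evaluation code `C(D, A) = ev_D(L(A))`, where `D = P 0 + ⋯ + P (l - 1)`. -/
def evalCode {l : ℕ} (P : Fin l → Place F K) (A : Place F K →₀ ℤ) : Set (Fin l → F) :=
  (fun (f : K) (i : Fin l) => (P i).eval f) '' rrSpace A

/-- `H^*(Q)`: the `m ∈ ℕ` such that `C(D, (m - 1) Q) ≠ C(D, m Q)`. -/
def Hstar {l : ℕ} (P : Fin l → Place F K) (Q : Place F K) : Set ℕ :=
  {m | evalCode P (Finsupp.single Q ((m : ℤ) - 1)) ≠ evalCode P (Finsupp.single Q (m : ℤ))}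

/-- Functions `M 0, …, M (l - 1)` that give a kernel of the pointed curve with point `Q` and
divisor `D = P 0 + ⋯ + P (l - 1)`: if `m 0 < ⋯ < m (l - 1)` are the elements of `H^*(Q)`, then
`M k` lies in `L(m_k Q)` and not in `L((m_k - 1) Q)`. -/
def IsKernelBasis {l : ℕ} (P : Fin l → Place F K) (Q : Place F K) (M : Fin l → K) : Prop :=
  ∃ m : Fin l → ℕ, StrictMono m ∧ Set.range m = Hstar P Q ∧
    ∀ k, M k ∈ rrSpace (Finsupp.single Q (m k : ℤ)) ∧
      M k ∉ rrSpace (Finsupp.single Q ((m k : ℤ) - 1))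

/-- The kernel: the evaluation matrix of the functions `M k`. The rows are ordered by decreasing
pole order, the last row being the evaluation of `M 0`. -/
def kernelMatrix {l : ℕ} (P : Fin l → Place F K) (M : Fin l → K) : Matrix (Fin l) (Fin l) F :=
  Matrix.of fun r c => (P c).eval (M r.rev)

end Codes

/-! Discrete memoryless channels; `W x y` is the transition probability `W(y | x)`. -/

/-- `W : X → O` is a discrete memoryless channel. -/
def IsChannel {X O : Type*} [Fintype O] (W : X → O → ℝ) : Prop :=
  (∀ x y, 0 ≤ W x y) ∧ ∀ x, ∑ y, W x y = 1

/-- `W` is symmetric with respect to the field operations (SOF): it is symmetric with respect to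
the addition and to the product. -/
def IsSOF {F O : Type*} [Field F] (W : F → O → ℝ) : Prop :=
  (∃ σ : F → Equiv.Perm O, ∀ x x' y, W x y = W x' (σ (x' - x) y)) ∧
  (∃ ψ : Fˣ → Equiv.Perm O, ∀ (a : Fˣ) (x : F) (y : O), W x y = W (a * x) (ψ a y))

open Classical in
/-- The Bhattacharyya parameter `Z(W)`. -/
def bhattacharyya {F O : Type*} [Fintype F] [Fintype O] (W : F → O → ℝ) : ℝ :=
  1 / ((Fintype.card F : ℝ) * ((Fintype.card F : ℝ) - 1)) *
    ∑ x : F, ∑ x' : F, if x ≠ x' then ∑ y : O, √(W x y * W x' y) else 0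

open Classical in
/-- The `i`-th split channel (indices start at `0`) obtained from `W` and an `N × N` matrix `T`:
with input `x`, output `y` and past inputs `u₀, …, u_{i-1}`,
it is the average over the future inputs of `∏ k, W (y k | (u T) k)`, where `u i = x`; the factor
`1 / q ^ (N - 1)` makes it a channel. -/
def splitChannel {F O : Type*} [Field F] [Fintype F] {N : ℕ} (W : F → O → ℝ)
    (T : Matrix (Fin N) (Fin N) F) (i : Fin N) :
    F → (Fin N → O) × (Fin (i : ℕ) → F) → ℝ :=
  fun x out =>
    1 / (Fintype.card F : ℝ) ^ (N - 1) *
      ∑ u : Fin N → F,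
        if u i = x ∧ ∀ j : Fin (i : ℕ), u (j.castLE i.isLt.le) = out.2 j then
          ∏ k, W (Matrix.vecMul u T k) (out.1 k)
        else 0

/-! The polarization process. -/

/-- The `l`-ary digits of `k < l ^ n`: `k = ∑ t, digits k t * l ^ t`. -/
def digits {l n : ℕ} (k : Fin (l ^ n)) : Fin n → Fin l :=
  finFunctionFinEquiv.symm k

/-- The number whose `l`-ary digits are those of `k` in the reverse order. -/
def digitReverse {l n : ℕ} (k : Fin (l ^ n)) : Fin (l ^ n) :=
  finFunctionFinEquiv fun t => digits k t.rev

/-- The Kronecker power `G ⊗ ⋯ ⊗ G` with `n` factors. -/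
def kroneckerPow {F : Type*} [Field F] {l : ℕ} (G : Matrix (Fin l) (Fin l) F) (n : ℕ) :
    Matrix (Fin (l ^ n)) (Fin (l ^ n)) F :=
  Matrix.of fun i j => ∏ t, G (digits i t) (digits j t)

/-- `G_n = B_n G^{⊗ n}`, where `B_n` is the digit-reversal permutation matrix. -/
def polarMatrix {F : Type*} [Field F] {l : ℕ} (G : Matrix (Fin l) (Fin l) F) (n : ℕ) :
    Matrix (Fin (l ^ n)) (Fin (l ^ n)) F :=
  (kroneckerPow G n).submatrix digitReverse id

/-- `Z(M^n_k)`: the Bhattacharyya parameter of the split channel `W_n^{(l ^ n - k)}` (numbered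
from `1`). For the kernel given by functions `M 0, …, M (l - 1)`, row `l ^ n - k` of `G_n` is the
evaluation of `M^n_k = M_{k_1}(X_1) ⋯ M_{k_n}(X_n)`, with `k_1, …, k_n` the digits of `k`. -/
def polarZ {F O : Type*} [Field F] [Fintype F] [Fintype O] {l : ℕ} (W : F → O → ℝ)
    (G : Matrix (Fin l) (Fin l) F) (n : ℕ) (k : Fin (l ^ n)) : ℝ :=
  bhattacharyya (splitChannel W (polarMatrix G n) k.rev)

/-- The code `C_A` spanned by the evaluations of the `M^n_k` with `k ∈ A` is a polar code for the
channel `W`: `Z(M^n_k) ≤ Z(M^n_j)` for all `k ∈ A` and `j ∉ A`. -/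
def IsPolarCode {F O : Type*} [Field F] [Fintype F] [Fintype O] {l : ℕ} (W : F → O → ℝ)
    (G : Matrix (Fin l) (Fin l) F) (n : ℕ) (A : Set (Fin (l ^ n))) : Prop :=
  ∀ k ∈ A, ∀ j ∉ A, polarZ W G n k ≤ polarZ W G n j

/-- The code `C_A` is weakly decreasing: if `M^n_k ∈ A` and every `l`-ary digit of `j` is at most
the corresponding digit of `k`, then `M^n_j ∈ A`. -/
def IsWeaklyDecreasing {l n : ℕ} (A : Set (Fin (l ^ n))) : Prop :=
  ∀ k ∈ A, ∀ j, (∀ t, digits j t ≤ digits k t) → j ∈ A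

end PolarAG

end

noncomputable section

namespace PolarAG

/-! ### Data processing for Bhattacharyya sums -/

/-! A rational curve with rational point `Q` has a coordinate `x` whose only pole is a simple one at
`Q`. The spaces `L((n - 1)Q)` are then the polynomials in `x` of degree less than `n`, and the
points `P i` are distinct values `a i` of `x` (`IsRationalCurve.exists_coordinate`). Interpolation
shows that there are no gaps, and a kernel is a Vandermonde matrix up to a triangular change of
basis.

A polar code is defined by non-strict inequalities, so weak decrease needs a strict one: `polarZ` is
strictly smaller at a number whose digits are smaller (`bhattacharyya_polarMatrix_lt`). Multiplying
by `x - a α` raises degrees by one, so it moves each row to the preceding one, modulo later rows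
(`hasMultipliers_of_degree`). The receiver of a symmetric channel can simulate this multiplication:
permute the output where the factor is nonzero, resample it where the factor is zero. The split
channel of the lower degree therefore degrades to that of the higher degree, and Cauchy-Schwarz
gives the weak inequality.

In case of equality, let the multiplier vanish at position `p`. The degradation then ignores the
`p`-th output, so the output laws for inputs 0 and 1 are proportional when only that output varies.
This holds for all `p`. The joint support is a union of boxes that meet pairwise because `Z(W) > 0`,
so the two laws are equal (`eq_of_proportional_of_boxes`). But `Z(W) < 1` and the invertibility of
the matrix let additive characters tell them apart (`condProb_zero_ne_one`). -/

theorem mul_eq_mul_of_sum_mul_sq_eq {ι : Type*} (s : Finset ι) (a b : ι → ℝ)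
    (h : (∑ i ∈ s, a i * b i) ^ 2 = (∑ i ∈ s, a i ^ 2) * ∑ i ∈ s, b i ^ 2) :
    ∀ i ∈ s, ∀ j ∈ s, a i * b j = a j * b i := by
  -- Lagrange's identity: this double sum is twice the defect in Cauchy-Schwarz.
  have key : ∑ i ∈ s, ∑ j ∈ s, (a i * b j - a j * b i) ^ 2 = 0 := by
    have e : ∀ i j, (a i * b j - a j * b i) ^ 2
        = a i ^ 2 * b j ^ 2 - 2 * ((a i * b i) * (a j * b j)) + b i ^ 2 * a j ^ 2 := by
      intro i j; ring
    simp only [e, Finset.sum_add_distrib, Finset.sum_sub_distrib, ← Finset.mul_sum]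
    simp only [← Finset.sum_mul]
    linarith [h]
  intro i hi j hj
  rw [Finset.sum_eq_zero_iff_of_nonneg
    (fun i _ => Finset.sum_nonneg fun j _ => sq_nonneg _)] at key
  have k2 := key i hi
  rw [Finset.sum_eq_zero_iff_of_nonneg (fun j _ => sq_nonneg _)] at k2
  have := pow_eq_zero_iff (two_ne_zero) |>.1 (k2 j hj)
  linarith

section DataProcessing

variable {Y Y' : Type*} [Fintype Y] {T : Y → Y' → ℝ} {P Q : Y → ℝ}

theorem sum_kernel_le (hT : ∀ y y', 0 ≤ T y y') (hP : ∀ y, 0 ≤ P y) (hQ : ∀ y, 0 ≤ Q y) (y' : Y') :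
    ∑ y, √(T y y' * P y) * √(T y y' * Q y)
      ≤ √((∑ y, T y y' * P y) * ∑ y, T y y' * Q y) := by
  rw [Real.sqrt_mul (Finset.sum_nonneg fun y _ => mul_nonneg (hT _ _) (hP _))]
  exact Real.sum_sqrt_mul_sqrt_le _ (fun y => mul_nonneg (hT _ _) (hP _))
    (fun y => mul_nonneg (hT _ _) (hQ _))

variable [Fintype Y']

theorem sum_sqrt_mul_eq_sum_kernel (hT : ∀ y y', 0 ≤ T y y') (hT1 : ∀ y, ∑ y', T y y' = 1)
    (hP : ∀ y, 0 ≤ P y) :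
    ∑ y, √(P y * Q y) = ∑ y', ∑ y, √(T y y' * P y) * √(T y y' * Q y) := by
  rw [Finset.sum_comm]
  refine Finset.sum_congr rfl fun y _ => ?_
  have : ∀ y', √(T y y' * P y) * √(T y y' * Q y) = T y y' * √(P y * Q y) := by
    intro y'
    rw [← Real.sqrt_mul (mul_nonneg (hT _ _) (hP _)),
      show T y y' * P y * (T y y' * Q y) = T y y' ^ 2 * (P y * Q y) by ring,
      Real.sqrt_mul (sq_nonneg _), Real.sqrt_sq (hT _ _)]
  simp_rw [this, ← Finset.sum_mul, hT1, one_mul]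

theorem sum_sqrt_mul_le_of_kernel (hT : ∀ y y', 0 ≤ T y y') (hT1 : ∀ y, ∑ y', T y y' = 1)
    (hP : ∀ y, 0 ≤ P y) (hQ : ∀ y, 0 ≤ Q y) :
    ∑ y, √(P y * Q y) ≤ ∑ y', √((∑ y, T y y' * P y) * ∑ y, T y y' * Q y) := by
  rw [sum_sqrt_mul_eq_sum_kernel hT hT1 hP]
  exact Finset.sum_le_sum fun y' _ => sum_kernel_le hT hP hQ y'

/-- No loss in total means equality in Cauchy-Schwarz at every `y'`, so `P` and `Q` are proportional
on the symbols that can lead to `y'`. -/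
theorem mul_eq_mul_of_sum_sqrt_mul_eq (hT : ∀ y y', 0 ≤ T y y') (hT1 : ∀ y, ∑ y', T y y' = 1)
    (hP : ∀ y, 0 ≤ P y) (hQ : ∀ y, 0 ≤ Q y)
    (h : ∑ y, √(P y * Q y) = ∑ y', √((∑ y, T y y' * P y) * ∑ y, T y y' * Q y))
    {y₁ y₂ : Y} {y' : Y'} (h₁ : 0 < T y₁ y') (h₂ : 0 < T y₂ y') :
    P y₁ * Q y₂ = P y₂ * Q y₁ := by
  rw [sum_sqrt_mul_eq_sum_kernel hT hT1 hP,
    Finset.sum_eq_sum_iff_of_le fun y' _ => sum_kernel_le hT hP hQ y'] at h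
  have h := congrArg (· ^ 2) (h y' (Finset.mem_univ _))
  have n1 : 0 ≤ ∑ y, T y y' * P y := Finset.sum_nonneg fun y _ => mul_nonneg (hT _ _) (hP _)
  have n2 : 0 ≤ ∑ y, T y y' * Q y := Finset.sum_nonneg fun y _ => mul_nonneg (hT _ _) (hQ _)
  have s1 : ∀ y, √(T y y' * P y) ^ 2 = T y y' * P y :=
    fun y => Real.sq_sqrt (mul_nonneg (hT _ _) (hP _))
  have s2 : ∀ y, √(T y y' * Q y) ^ 2 = T y y' * Q y :=
    fun y => Real.sq_sqrt (mul_nonneg (hT _ _) (hQ _))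
  have e := mul_eq_mul_of_sum_mul_sq_eq Finset.univ (fun y => √(T y y' * P y))
    (fun y => √(T y y' * Q y)) (by simpa [s1, s2, Real.sq_sqrt (mul_nonneg n1 n2)] using h)
    y₁ (Finset.mem_univ _) y₂ (Finset.mem_univ _)
  have e := congrArg (· ^ 2) e
  simp only [mul_pow, s1, s2] at e
  have hne : T y₁ y' * T y₂ y' ≠ 0 := (mul_pos h₁ h₂).ne'
  apply mul_left_cancel₀ hne
  linarith

end DataProcessing

/-! ### Symmetric channels -/

section SOF

variable {F O : Type*} [Field F] {W : F → O → ℝ}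

theorem IsSOF.exists_affine_perm (h : IsSOF W) {b : F} (hb : b ≠ 0) (e : F) :
    ∃ ρ : Equiv.Perm O, ∀ x y, W x y = W (b * x + e) (ρ y) := by
  obtain ⟨⟨σ, hσ⟩, ψ, hψ⟩ := h
  refine ⟨(ψ (Units.mk0 b hb)).trans (σ e), fun x y => ?_⟩
  rw [hψ (Units.mk0 b hb) x y, hσ _ (b * x + e)]
  simp

-- The post-processing that simulates `x ↦ b * x + e` on the input: a permutation of the outputs if
-- `b ≠ 0`, a fresh sample of `W e` if `b = 0`. In the second case the old output is forgotten,
-- which is the source of strictness later.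
open Classical in
theorem IsSOF.exists_affine_kernel [Fintype O] (hW : IsChannel W) (h : IsSOF W) :
    ∃ t : F → F → O → O → ℝ, (∀ b e y y', 0 ≤ t b e y y') ∧ (∀ b e y, ∑ y', t b e y y' = 1) ∧
      (∀ b e x y', ∑ y, t b e y y' * W x y = W (b * x + e) y') ∧
      ∀ e y₁ y₂ y', t 0 e y₁ y' = t 0 e y₂ y' := by
  have hρ : ∀ b e : F, ∃ ρ : Equiv.Perm O, b ≠ 0 → ∀ x y, W x y = W (b * x + e) (ρ y) := by
    intro b e
    by_cases hb : b = 0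
    · exact ⟨1, fun h => absurd hb h⟩
    · obtain ⟨ρ, hρ⟩ := h.exists_affine_perm hb e
      exact ⟨ρ, fun _ => hρ⟩
  choose ρ hρ using hρ
  refine ⟨fun b e y y' => if b = 0 then W e y' else if y = (ρ b e).symm y' then 1 else 0,
    ?_, ?_, ?_, ?_⟩
  · intro b e y y'
    dsimp only
    split_ifs
    exacts [hW.1 _ _, zero_le_one, le_rfl]
  · intro b e y
    by_cases hb : b = 0
    · simp [hb, hW.2]
    · simp [hb, Equiv.eq_symm_apply]
  · intro b e x y'
    by_cases hb : b = 0
    · simp [hb, ← Finset.mul_sum, hW.2]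
    · simp [hb, hρ b e hb x]
  · intro e y₁ y₂ y'
    simp

variable [Fintype F] [Fintype O]

/-- Some pair of distinct inputs shares an output because `Z(W) > 0`; affine maps are transitive on
such pairs, and the channel is symmetric under them. -/
theorem IsSOF.exists_common_output (hW : IsChannel W) (h : IsSOF W) (hZ : 0 < bhattacharyya W)
    (x x' : F) : ∃ y, 0 < W x y ∧ 0 < W x' y := by
  classical
  by_cases hx : x = x'
  · subst hx
    by_contra! hcon
    have := hW.2 x
    rw [Finset.sum_eq_zero fun y _ => le_antisymm (not_lt.1 fun h => (hcon y h).not_gt h) (hW.1 _ _)]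
      at this
    exact zero_ne_one this
  have : ∃ a a' : F, a ≠ a' ∧ ∃ y, 0 < W a y ∧ 0 < W a' y := by
    by_contra! hcon
    refine hZ.ne' ?_
    rw [bhattacharyya, Finset.sum_eq_zero, mul_zero]
    intro a _
    refine Finset.sum_eq_zero fun a' _ => ?_
    split_ifs with haa
    · refine Finset.sum_eq_zero fun y _ => ?_
      rcases (hW.1 a y).eq_or_lt with h0 | h0
      · simp [← h0]
      · simp [le_antisymm (hcon a a' haa y h0) (hW.1 _ _)]
    · rfl
  obtain ⟨a, a', haa, y, hy, hy'⟩ := this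
  have ha : a' - a ≠ 0 := sub_ne_zero.2 (Ne.symm haa)
  have hb : (x' - x) / (a' - a) ≠ 0 := div_ne_zero (sub_ne_zero.2 (Ne.symm hx)) ha
  obtain ⟨ρ, hρ⟩ := h.exists_affine_perm hb (x - (x' - x) / (a' - a) * a)
  refine ⟨ρ y, ?_, ?_⟩
  · rw [hρ] at hy
    convert hy using 2
    ring
  · rw [hρ] at hy'
    convert hy' using 2
    field_simp
    ring

theorem IsChannel.exists_ne_of_bhattacharyya_lt_one (hW : IsChannel W)
    (hZ : bhattacharyya W < 1) : ∃ y x x', W x y ≠ W x' y := by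
  classical
  by_contra! hcon
  refine hZ.ne ?_
  have hq : (1 : ℝ) < Fintype.card F := by exact_mod_cast Fintype.one_lt_card
  have h1 : ∀ x x' : F, ∑ y, √(W x y * W x' y) = 1 := by
    intro x x'
    rw [← hW.2 x]
    refine Finset.sum_congr rfl fun y _ => ?_
    rw [hcon y x' x, Real.sqrt_mul_self (hW.1 _ _)]
  have h2 : ∀ x : F, ∑ x' : F, (if x ≠ x' then (1 : ℝ) else 0) = Fintype.card F - 1 := by
    intro x
    have : ∀ x', (if x ≠ x' then (1 : ℝ) else 0) = 1 - if x = x' then 1 else 0 := by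
      intro x'; split_ifs <;> simp_all
    simp [this]
  unfold bhattacharyya
  simp only [h1, h2, Finset.sum_const, Finset.card_univ, nsmul_eq_mul]
  have : (Fintype.card F : ℝ) - 1 ≠ 0 := by linarith
  field_simp

end SOF

/-! ### Split channels of symmetric channels -/

section Split

open scoped Matrix

variable {F O : Type*} [Field F] [Fintype F] {N : ℕ}

/-- The probability of the block `y` when the codeword `c` is sent. -/
def blockProb (W : F → O → ℝ) (c : Fin N → F) (y : Fin N → O) : ℝ :=
  ∏ k, W (c k) (y k)

open Classical in
/-- The inputs whose coordinates before `i` vanish and whose `i`-th coordinate is `x`. -/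
def inputs (i : Fin N) (x : F) : Finset (Fin N → F) :=
  {u | u i = x ∧ ∀ j < i, u j = 0}

/-- The probability of `y` when the input is uniformly distributed on `inputs i x`. -/
def condProb (W : F → O → ℝ) (T : Matrix (Fin N) (Fin N) F) (i : Fin N) (x : F)
    (y : Fin N → O) : ℝ :=
  (∑ u ∈ inputs i x, blockProb W (u ᵥ* T) y) / (inputs i (0 : F)).card

theorem mem_inputs {i : Fin N} {x : F} {u : Fin N → F} :
    u ∈ inputs i x ↔ u i = x ∧ ∀ j < i, u j = 0 := by
  simp [inputs]

theorem card_pow_mul_card_inputs (i : Fin N) (x : F) :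
    Fintype.card F ^ (i : ℕ) * (inputs i x).card = Fintype.card F ^ (N - 1) := by
  classical
  have h1 : inputs i x = Fintype.piFinset
      (fun j => if j < i then {0} else if j = i then {x} else Finset.univ) := by
    ext u
    simp only [mem_inputs, Fintype.mem_piFinset]
    constructor
    · rintro ⟨rfl, h⟩ j
      split_ifs with h1 h2
      · simpa using h j h1
      · simp [h2]
      · simp
    · intro h
      refine ⟨by simpa using h i, fun j hj => by simpa [hj] using h j⟩
  have h2 : Fintype.card F ^ (i : ℕ) = ∏ j : Fin N, if j < i then Fintype.card F else 1 := by
    rw [Finset.prod_ite, Finset.prod_const, Finset.prod_const_one, mul_one]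
    congr 1
    rw [← Fin.card_Iio i]
    congr 1
    ext; simp
  have h3 : Fintype.card F ^ (N - 1) = ∏ j : Fin N, if j = i then 1 else Fintype.card F := by
    rw [Finset.prod_ite, Finset.prod_const_one, Finset.prod_const, one_mul,
      Finset.filter_ne', Finset.card_erase_of_mem (Finset.mem_univ _), Finset.card_univ,
      Fintype.card_fin]
  rw [h1, Fintype.card_piFinset, h2, h3, ← Finset.prod_mul_distrib]
  refine Finset.prod_congr rfl fun j _ => ?_
  rcases lt_trichotomy j i with h | h | h
  · simp [h, h.ne]
  · simp [h]
  · simp [h.not_gt, h.ne']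

theorem card_inputs_pos (i : Fin N) (x : F) : 0 < (inputs i x).card := by
  have := card_pow_mul_card_inputs i x
  have h2 : 0 < Fintype.card F ^ (N - 1) := pow_pos Fintype.card_pos _
  rw [← this] at h2
  exact Nat.pos_of_mul_pos_left h2

theorem card_inputs_eq (i : Fin N) (x : F) : (inputs i x).card = (inputs i (0 : F)).card :=
  Nat.eq_of_mul_eq_mul_left (pow_pos Fintype.card_pos _)
    ((card_pow_mul_card_inputs i x).trans (card_pow_mul_card_inputs i 0).symm)

omit [Fintype F] in
theorem IsSOF.exists_block_perm {W : F → O → ℝ} (h : IsSOF W) {b : F} (hb : b ≠ 0)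
    (d : Fin N → F) :
    ∃ ρ : Equiv.Perm (Fin N → O), ∀ c y, blockProb W c y = blockProb W (b • c + d) (ρ y) := by
  choose ρ hρ using fun k => h.exists_affine_perm hb (d k)
  refine ⟨Equiv.piCongrRight ρ, fun c y => ?_⟩
  simp only [blockProb]
  refine Finset.prod_congr rfl fun k _ => ?_
  rw [hρ k]
  simp

variable [Fintype O]

/-- By affine symmetry all pasts and all pairs of distinct inputs contribute equally, so the zero
past and the inputs 0 and 1 suffice. -/
theorem bhattacharyya_splitChannel {W : F → O → ℝ} (h : IsSOF W)
    (T : Matrix (Fin N) (Fin N) F) (i : Fin N) :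
    bhattacharyya (splitChannel W T i) =
      ∑ y, √(condProb W T i 0 y * condProb W T i 1 y) := by
  classical
  set q := Fintype.card F with hq
  set I : F → (Fin N → O) → ℝ := fun x y => ∑ u ∈ inputs i x, blockProb W (u ᵥ* T) y with hI
  have key : ∀ x x' : F, x ≠ x' → ∀ past : Fin (i : ℕ) → F, ∃ ρ : Equiv.Perm (Fin N → O),
      ∀ y, splitChannel W T i x (ρ y, past) = 1 / (q : ℝ) ^ (N - 1) * I 0 y ∧
        splitChannel W T i x' (ρ y, past) = 1 / (q : ℝ) ^ (N - 1) * I 1 y := by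
    intro x x' hx past
    have ha : x' - x ≠ 0 := sub_ne_zero.2 hx.symm
    -- The map `u ↦ (x' - x) • u + u₀` carries `inputs i z` onto the inputs with the given past and
    -- `i`-th entry `(x' - x) * z + x`; this entry is `x` for `z = 0` and `x'` for `z = 1`.
    set u₀ : Fin N → F := fun j => if hj : j < i then past ⟨j, hj⟩ else if j = i then x else 0
      with hu₀
    have hi : u₀ i = x := by simp [hu₀]
    have hj : ∀ j : Fin (i : ℕ), u₀ (j.castLE i.isLt.le) = past j := by
      intro j
      have : j.castLE i.isLt.le < i := by simp [Fin.lt_def]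
      simp [hu₀, this]
    let e : Equiv.Perm (Fin N → F) :=
      (MulAction.toPerm (Units.mk0 _ ha)).trans (Equiv.addRight u₀)
    have he : ∀ u, e u = (x' - x) • u + u₀ := fun u => rfl
    obtain ⟨ρ, hρ⟩ := h.exists_block_perm (O := O) ha (u₀ ᵥ* T)
    have main : ∀ (z : F) (y : Fin N → O),
        splitChannel W T i ((x' - x) * z + x) (ρ y, past) = 1 / (q : ℝ) ^ (N - 1) * I z y := by
      intro z y
      unfold splitChannel
      congr 1
      rw [← Equiv.sum_comp e, ← Finset.sum_filter, hI]
      refine Finset.sum_congr ?_ fun u _ => ?_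
      · ext u
        simp only [Finset.mem_filter, Finset.mem_univ, true_and, mem_inputs, he, Pi.add_apply,
          Pi.smul_apply, smul_eq_mul, hi, hj, add_left_inj, add_eq_right,
          mul_eq_zero, ha, false_or, mul_right_inj' ha]
        refine and_congr_right fun _ => ⟨fun hu j hji => ?_, fun hu j => hu _ (by simp [Fin.lt_def])⟩
        exact hu ⟨j, hji⟩
      · rw [hρ, he, Matrix.add_vecMul, Matrix.smul_vecMul]
        rfl
    refine ⟨ρ, fun y => ⟨?_, ?_⟩⟩
    · simpa using main 0 y
    · simpa using main 1 y
  have hq1 : (1 : ℝ) < q := by exact_mod_cast Fintype.one_lt_card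
  have hcard : (q : ℝ) ^ (i : ℕ) * (inputs i (0 : F)).card = (q : ℝ) ^ (N - 1) := by
    exact_mod_cast card_pow_mul_card_inputs i (0 : F)
  have hc0 : (0 : ℝ) < (inputs i (0 : F)).card := by exact_mod_cast card_inputs_pos i (0 : F)
  have pair : ∀ x x' : F, x ≠ x' →
      ∑ out, √(splitChannel W T i x out * splitChannel W T i x' out) =
        ∑ y, √(condProb W T i 0 y * condProb W T i 1 y) := by
    intro x x' hx
    rw [Fintype.sum_prod_type_right]
    have : ∀ past, ∑ y, √(splitChannel W T i x (y, past) * splitChannel W T i x' (y, past)) =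
        1 / (q : ℝ) ^ (N - 1) * ∑ y, √(I 0 y * I 1 y) := by
      intro past
      obtain ⟨ρ, hρ⟩ := key x x' hx past
      rw [← Equiv.sum_comp ρ, Finset.mul_sum]
      refine Finset.sum_congr rfl fun y _ => ?_
      rw [(hρ y).1, (hρ y).2, mul_mul_mul_comm, Real.sqrt_mul (by positivity),
        Real.sqrt_mul_self (by positivity)]
    simp only [this, Finset.sum_const, Finset.card_univ, Fintype.card_fun, Fintype.card_fin,
      nsmul_eq_mul, ← hq]
    have : ∀ y, √(condProb W T i 0 y * condProb W T i 1 y) =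
        1 / ((inputs i (0 : F)).card : ℝ) * √(I 0 y * I 1 y) := by
      intro y
      rw [condProb, condProb, div_mul_div_comm, Real.sqrt_div' _ (by positivity),
        Real.sqrt_mul_self hc0.le, one_div_mul_eq_div]
    simp only [this, ← Finset.mul_sum]
    rw [← mul_assoc]
    congr 1
    push_cast
    rw [← hcard]
    field_simp
  have h2 : ∀ (x : F) (c : ℝ), ∑ x' : F, (if x ≠ x' then c else 0) = (q - 1) * c := by
    intro x c
    have : ∀ x', (if x ≠ x' then c else 0) = c - if x = x' then c else 0 := by
      intro x'; split_ifs <;> simp_all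
    simp [this, sub_mul, hq]
  unfold bhattacharyya
  rw [Finset.sum_congr rfl fun x _ => Finset.sum_congr rfl fun x' _ =>
    show _ = (if x ≠ x' then ∑ y, √(condProb W T i 0 y * condProb W T i 1 y) else 0) from ?_]
  · simp only [h2, Finset.sum_const, Finset.card_univ, nsmul_eq_mul, ← hq]
    have : (q : ℝ) - 1 ≠ 0 := by linarith
    field_simp
  · split_ifs with hx
    · exact pair x x' hx
    · rfl

theorem condProb_nonneg {W : F → O → ℝ} (hW : IsChannel W) (T : Matrix (Fin N) (Fin N) F)
    (i : Fin N) (x : F) (y : Fin N → O) : 0 ≤ condProb W T i x y :=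
  div_nonneg (Finset.sum_nonneg fun _ _ => Finset.prod_nonneg fun _ _ => hW.1 _ _)
    (Nat.cast_nonneg _)

theorem sum_prod_eq_prod_sum {R : Type*} [CommSemiring R] (f : Fin N → O → R) :
    ∑ y : Fin N → O, ∏ k, f k (y k) = ∏ k, ∑ o, f k o := by
  classical
  rw [Finset.prod_univ_sum, Fintype.piFinset_univ]

omit [Field F] [Fintype F] in
theorem sum_blockProb {W : F → O → ℝ} (hW : IsChannel W) (c : Fin N → F) :
    ∑ y, blockProb W c y = 1 := by
  simp [blockProb, sum_prod_eq_prod_sum fun k => W (c k), hW.2]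

theorem sum_condProb {W : F → O → ℝ} (hW : IsChannel W) (T : Matrix (Fin N) (Fin N) F)
    (i : Fin N) (x : F) : ∑ y, condProb W T i x y = 1 := by
  have hc0 : ((inputs i (0 : F)).card : ℝ) ≠ 0 := by exact_mod_cast (card_inputs_pos i (0 : F)).ne'
  simp only [condProb]
  rw [← Finset.sum_div, Finset.sum_comm]
  simp [sum_blockProb hW, card_inputs_eq i x, hc0]

end Split

/-! ### Strict monotonicity of the Bhattacharyya parameters -/

section Characters

variable {F O : Type*} [Field F] [Fintype F] [Fintype O]

/-- By Fourier inversion, a function whose nontrivial coefficients all vanish is constant. -/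
theorem exists_fourier_coeff_ne_zero (w : F → ℂ) {x x' : F} (h : w x ≠ w x') :
    ∃ χ : AddChar F ℂ, χ ≠ 0 ∧ ∑ a, w a * χ (-a) ≠ 0 := by
  classical
  by_contra! hcon
  refine h ?_
  have key : ∀ z, (Fintype.card F : ℂ) * w z = ∑ a, w a := by
    intro z
    have h1 : ∑ χ : AddChar F ℂ, ∑ a, w a * χ (z - a) = ∑ a, w a := by
      rw [Finset.sum_eq_single 0]
      · simp
      · intro χ _ hχ
        simp only [sub_eq_add_neg, AddChar.map_add_eq_mul]
        rw [Finset.sum_congr rfl fun a _ => mul_left_comm (w a) (χ z) (χ (-a)), ← Finset.mul_sum,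
          hcon χ hχ, mul_zero]
      · simp
    rw [← h1, Finset.sum_comm]
    simp only [← Finset.mul_sum, AddChar.sum_apply_eq_ite, sub_eq_zero]
    simp [mul_comm]
  have hq : (Fintype.card F : ℂ) ≠ 0 := by exact_mod_cast Fintype.card_ne_zero
  exact mul_left_cancel₀ hq ((key x).trans (key x').symm)

omit [Fintype F] in
theorem addChar_map_sum {ι : Type*} (s : Finset ι) (χ : AddChar F ℂ) (f : ι → F) :
    χ (∑ k ∈ s, f k) = ∏ k ∈ s, χ (f k) := by
  classical
  induction s using Finset.induction_on with
  | empty => simp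
  | insert a s ha ih => rw [Finset.sum_insert ha, Finset.prod_insert ha, AddChar.map_add_eq_mul, ih]

/-- The likelihood functions of a nonconstant symmetric channel span the additive characters. -/
theorem IsSOF.exists_character_combination {W : F → O → ℝ} (hW : IsChannel W) (h : IsSOF W)
    (hne : ∃ y x x', W x y ≠ W x' y) :
    ∃ χ : AddChar F ℂ, χ ≠ 0 ∧ ∀ b, ∃ c : O → ℂ, ∀ x, ∑ y, c y * (W x y : ℂ) = χ (b * x) := by
  classical
  obtain ⟨y₀, x₀, x₁, hx⟩ := hne
  obtain ⟨χ, hχ, hs⟩ := exists_fourier_coeff_ne_zero (fun x => (W x y₀ : ℂ)) (x := x₀) (x' := x₁)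
    (by exact_mod_cast hx)
  refine ⟨χ, hχ, fun b => ?_⟩
  by_cases hb : b = 0
  · refine ⟨fun _ => 1, fun x => ?_⟩
    simp only [hb, one_mul, zero_mul, AddChar.map_zero_eq_one]
    exact_mod_cast hW.2 x
  set s := ∑ a, (W a y₀ : ℂ) * χ (-a) with hsdef
  choose ρ hρ using fun a : F => h.exists_affine_perm hb a
  -- By symmetry the likelihood of `(ρ a).symm y₀` at `x` is that of `y₀` at `b * x + a`. Weighting
  -- these translates by `χ (-a)` extracts `χ (b * x)` times the coefficient `s`.
  refine ⟨fun y => ∑ a, s⁻¹ * χ (-a) * if y = (ρ a).symm y₀ then 1 else 0, fun x => ?_⟩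
  simp only [Finset.sum_mul]
  rw [Finset.sum_comm]
  have : ∀ a, ∑ y, s⁻¹ * χ (-a) * (if y = (ρ a).symm y₀ then 1 else 0) * (W x y : ℂ) =
      s⁻¹ * χ (b * x) * ((W (b * x + a) y₀ : ℂ) * χ (-(b * x + a))) := by
    intro a
    have e : χ (-a) = χ (b * x) * χ (-(b * x + a)) := by
      rw [← AddChar.map_add_eq_mul]; congr 1; ring
    simp only [mul_ite, mul_one, mul_zero, ite_mul, zero_mul, Finset.sum_ite_eq',
      Finset.mem_univ, if_true, hρ a x, Equiv.apply_symm_apply]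
    rw [e]; ring
  simp only [this, ← Finset.mul_sum]
  have hshift : ∑ a, (W (b * x + a) y₀ : ℂ) * χ (-(b * x + a)) = s :=
    Equiv.sum_comp (Equiv.addLeft (b * x)) fun z => (W z y₀ : ℂ) * χ (-z)
  rw [hshift, mul_right_comm, inv_mul_cancel₀ hs, one_mul]

end Characters

/-! ### Strict data processing for split channels -/

section Strict

open scoped Matrix

variable {F O : Type*} [Field F] [Fintype F] [Fintype O] {N : ℕ}

/-- The input symbol is a linear form in the codeword, so its character is a product of characters
of the codeword symbols. Each of these is a combination of likelihoods, so a linear functional of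
the output law takes the value `χ (a * x)`. -/
theorem condProb_zero_ne_one {W : F → O → ℝ} (hW : IsChannel W) (h : IsSOF W)
    (hZ : bhattacharyya W < 1) {T : Matrix (Fin N) (Fin N) F} (hT : IsUnit T.det) (i : Fin N) :
    condProb W T i 0 ≠ condProb W T i 1 := by
  intro heq
  obtain ⟨χ, hχ, hc⟩ := h.exists_character_combination hW (hW.exists_ne_of_bhattacharyya_lt_one hZ)
  obtain ⟨a, ha⟩ := (AddChar.ne_zero_iff).1 hχ
  set v : Fin N → F := fun k => T⁻¹ k i with hv
  have huv : ∀ u : Fin N → F, ∑ k, v k * (u ᵥ* T) k = u i := by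
    intro u
    have : ((u ᵥ* T) ᵥ* T⁻¹) i = u i := by
      rw [Matrix.vecMul_vecMul, Matrix.mul_nonsing_inv _ hT, Matrix.vecMul_one]
    rw [← this, Matrix.vecMul, dotProduct]
    exact Finset.sum_congr rfl fun k _ => mul_comm _ _
  choose c hc using fun k => hc (a * v k)
  have hcard : ((inputs i (0 : F)).card : ℂ) ≠ 0 := by
    exact_mod_cast (card_inputs_pos i (0 : F)).ne'
  have key : ∀ x : F, ∑ y : Fin N → O, (∏ k, c k (y k)) * (condProb W T i x y : ℂ) = χ (a * x) := by
    intro x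
    have h1 : ∀ u ∈ inputs i x,
        ∑ y : Fin N → O, (∏ k, c k (y k)) * (blockProb W (u ᵥ* T) y : ℂ) = χ (a * x) := by
      intro u hu
      have : ∀ y : Fin N → O, (∏ k, c k (y k)) * (blockProb W (u ᵥ* T) y : ℂ) =
          ∏ k, (c k (y k) * (W ((u ᵥ* T) k) (y k) : ℂ)) := by
        intro y
        rw [blockProb, Finset.prod_mul_distrib]
        push_cast
        rfl
      simp only [this]
      rw [sum_prod_eq_prod_sum fun k o => c k o * (W ((u ᵥ* T) k) o : ℂ)]
      simp only [hc]
      rw [← addChar_map_sum, ← (mem_inputs.1 hu).1, ← huv u, Finset.mul_sum]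
      simp only [mul_assoc]
    simp only [condProb]
    push_cast
    simp only [mul_div_assoc', ← Finset.sum_div, Finset.mul_sum]
    rw [Finset.sum_comm, Finset.sum_congr rfl h1, Finset.sum_const, card_inputs_eq, nsmul_eq_mul,
      mul_div_cancel_left₀ _ hcard]
  have h0 := key 0
  have h1 := key 1
  rw [← heq, h0] at h1
  simp only [mul_zero, AddChar.map_zero_eq_one, mul_one] at h1
  exact ha h1.symm

/-- Proportionality passes only through a nonzero middle pair; hence the attention to the joint
support below. -/
theorem proportional_trans {p₁ p₂ p₃ q₁ q₂ q₃ : ℝ} (h₁ : p₁ * q₂ = p₂ * q₁)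
    (h₂ : p₂ * q₃ = p₃ * q₂) (h : p₂ ≠ 0 ∨ q₂ ≠ 0) : p₁ * q₃ = p₃ * q₁ := by
  rcases h with h | h
  · apply mul_left_cancel₀ h
    linear_combination p₁ * h₂ + p₃ * h₁
  · apply mul_left_cancel₀ h
    linear_combination q₃ * h₁ + q₁ * h₂

/-- Two functions on blocks are equal if they are proportional along every coordinate, and their
joint support is a union of boxes any two of which meet. -/
theorem eq_of_proportional_of_boxes {P Q : (Fin N → O) → ℝ} (B : Set (Fin N → Set O))
    (hB : ∀ y, (P y ≠ 0 ∨ Q y ≠ 0) ↔ ∃ b ∈ B, ∀ k, y k ∈ b k)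
    (hmeet : ∀ b ∈ B, ∀ b' ∈ B, ∀ k, ∃ o, o ∈ b k ∧ o ∈ b' k)
    (hPQ : ∀ (p : Fin N) (y y' : Fin N → O), (∀ k ≠ p, y k = y' k) → P y * Q y' = P y' * Q y)
    (hP1 : ∑ y, P y = 1) (hQ1 : ∑ y, Q y = 1) : P = Q := by
  classical
  have path : ∀ b ∈ B, ∀ y w : Fin N → O, (∀ k, y k ∈ b k) → (∀ k, w k ∈ b k) →
      P y * Q w = P w * Q y := by
    intro b hb y w hy hw
    -- Replace the coordinates of `y` by those of `w` one at a time; every intermediate block stays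
    -- in the box `b`, hence in the joint support.
    have : ∀ s : Finset (Fin N), P y * Q (s.piecewise w y) = P (s.piecewise w y) * Q y := by
      intro s
      induction s using Finset.induction_on with
      | empty => simp
      | insert p s hp ih =>
        refine proportional_trans ih (hPQ p _ _ fun k hk => ?_) ((hB _).2 ⟨b, hb, fun k => ?_⟩)
        · simp [Finset.piecewise, hk]
        · by_cases hk : k ∈ s <;> simp [hk, hy, hw]
    simpa using this Finset.univ
  have all : ∀ y w, P y * Q w = P w * Q y := by
    intro y w
    by_cases hy : P y ≠ 0 ∨ Q y ≠ 0
    · by_cases hw : P w ≠ 0 ∨ Q w ≠ 0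
      · obtain ⟨b, hb, hyb⟩ := (hB y).1 hy
        obtain ⟨b', hb', hwb⟩ := (hB w).1 hw
        choose z hz hz' using hmeet b hb b' hb'
        exact proportional_trans (path b hb y z hyb hz) (path b' hb' z w hz' hwb)
          ((hB z).2 ⟨b, hb, hz⟩)
      · push Not at hw
        simp [hw.1, hw.2]
    · push Not at hy
      simp [hy.1, hy.2]
  funext y
  calc P y = ∑ w, P y * Q w := by rw [← Finset.mul_sum, hQ1, mul_one]
    _ = ∑ w, P w * Q y := Finset.sum_congr rfl fun w _ => all y w
    _ = Q y := by rw [← Finset.sum_mul, hP1, one_mul]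

theorem condProb_ne_zero_iff {W : F → O → ℝ} (hW : IsChannel W) (T : Matrix (Fin N) (Fin N) F)
    (i : Fin N) (x : F) (y : Fin N → O) :
    condProb W T i x y ≠ 0 ↔ ∃ u ∈ inputs i x, ∀ k, 0 < W ((u ᵥ* T) k) (y k) := by
  have hcard : ((inputs i (0 : F)).card : ℝ) ≠ 0 := by
    exact_mod_cast (card_inputs_pos i (0 : F)).ne'
  rw [condProb, div_ne_zero_iff, and_iff_left hcard, Ne,
    Finset.sum_eq_zero_iff_of_nonneg fun u _ => show 0 ≤ blockProb W (u ᵥ* T) y from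
      Finset.prod_nonneg fun k _ => hW.1 _ _]
  push Not
  refine exists_congr fun u => and_congr_right fun _ => ?_
  rw [blockProb, Finset.prod_ne_zero_iff]
  exact ⟨fun h k => (hW.1 _ _).lt_of_ne' (h k (Finset.mem_univ k)), fun h k _ => (h k).ne'⟩

/-- The hypothesis says that the channel `i` is obtained from the channel `i'` by multiplying
codewords with a vector that vanishes at an arbitrarily prescribed position. -/
theorem bhattacharyya_splitChannel_lt {W : F → O → ℝ} (hW : IsChannel W) (hS : IsSOF W)
    (hZ0 : 0 < bhattacharyya W) (hZ1 : bhattacharyya W < 1) {T : Matrix (Fin N) (Fin N) F}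
    (hT : IsUnit T.det) {i i' : Fin N}
    (H : ∀ p : Fin N, ∃ (h : Fin N → F) (A : Matrix (Fin N) (Fin N) F), h p = 0 ∧
      A * T = T * Matrix.diagonal h ∧ (∀ x, ∀ u ∈ inputs i' x, u ᵥ* A ∈ inputs i x)) :
    bhattacharyya (splitChannel W T i') < bhattacharyya (splitChannel W T i) := by
  classical
  rw [bhattacharyya_splitChannel hS, bhattacharyya_splitChannel hS]
  obtain ⟨t, ht0, ht1, htW, htc⟩ := hS.exists_affine_kernel hW
  have hcard : ((inputs i (0 : F)).card : ℝ) ≠ 0 := by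
    exact_mod_cast (card_inputs_pos i (0 : F)).ne'
  have hcard' : ((inputs i' (0 : F)).card : ℝ) ≠ 0 := by
    exact_mod_cast (card_inputs_pos i' (0 : F)).ne'
  -- The receiver simulates multiplication of the codeword by `h` and addition of the codeword of a
  -- uniformly random `d ∈ inputs i 0`.
  let K : (Fin N → F) → (Fin N → O) → (Fin N → O) → ℝ := fun h y y' =>
    (∑ d ∈ inputs i (0 : F), ∏ k, t (h k) ((d ᵥ* T) k) (y k) (y' k)) / (inputs i (0 : F)).card
  have hK0 : ∀ h y y', 0 ≤ K h y y' := fun h y y' =>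
    div_nonneg (Finset.sum_nonneg fun _ _ => Finset.prod_nonneg fun _ _ => ht0 _ _ _ _)
      (Nat.cast_nonneg _)
  have hK1 : ∀ h y, ∑ y', K h y y' = 1 := by
    intro h y
    simp only [K]
    rw [← Finset.sum_div, Finset.sum_comm]
    have : ∀ d : Fin N → F, ∑ y' : Fin N → O, ∏ k, t (h k) ((d ᵥ* T) k) (y k) (y' k) = 1 := by
      intro d
      rw [sum_prod_eq_prod_sum fun k => t (h k) ((d ᵥ* T) k) (y k)]
      simp [ht1]
    simp [this, hcard]
  have hKc : ∀ (h : Fin N → F) (A : Matrix (Fin N) (Fin N) F), A * T = T * Matrix.diagonal h →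
      (∀ x, ∀ u ∈ inputs i' x, u ᵥ* A ∈ inputs i x) → ∀ x y',
      ∑ y, K h y y' * condProb W T i' x y = condProb W T i x y' := by
    intro h A hA hAi x y'
    -- The random shift `d` makes `d + u ᵥ* A` uniform on `inputs i x`, so the result is the same
    -- for every `u`.
    have hblock : ∀ u ∈ inputs i' x,
        ∑ y, K h y y' * blockProb W (u ᵥ* T) y = condProb W T i x y' := by
      intro u hu
      have hd : ∀ d : Fin N → F, ∑ y : Fin N → O,
          (∏ k, t (h k) ((d ᵥ* T) k) (y k) (y' k)) * blockProb W (u ᵥ* T) y =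
            blockProb W ((d + u ᵥ* A) ᵥ* T) y' := by
        intro d
        simp only [blockProb, ← Finset.prod_mul_distrib]
        rw [sum_prod_eq_prod_sum
          fun k o => t (h k) ((d ᵥ* T) k) o (y' k) * W ((u ᵥ* T) k) o]
        refine Finset.prod_congr rfl fun k _ => ?_
        rw [htW, Matrix.add_vecMul, Matrix.vecMul_vecMul, hA, ← Matrix.vecMul_vecMul,
          Pi.add_apply, Matrix.vecMul_diagonal, add_comm, mul_comm]
      simp only [K, div_mul_eq_mul_div, ← Finset.sum_div, Finset.sum_mul]
      rw [Finset.sum_comm, condProb]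
      congr 1
      rw [Finset.sum_congr rfl fun d _ => hd d]
      have hm := mem_inputs.1 (hAi x u hu)
      refine Finset.sum_bij' (fun d _ => d + u ᵥ* A) (fun d _ => d - u ᵥ* A) ?_ ?_ ?_ ?_ ?_
      · intro d hdm
        rw [mem_inputs] at hdm ⊢
        refine ⟨by simp [hdm.1, hm.1], fun j hj => by simp [hdm.2 j hj, hm.2 j hj]⟩
      · intro d hdm
        rw [mem_inputs] at hdm ⊢
        refine ⟨by simp [hdm.1, hm.1], fun j hj => by simp [hdm.2 j hj, hm.2 j hj]⟩
      · simp
      · simp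
      · simp
    have hsum : ∀ y, K h y y' * condProb W T i' x y =
        (∑ u ∈ inputs i' x, K h y y' * blockProb W (u ᵥ* T) y) / (inputs i' (0 : F)).card := by
      intro y
      rw [condProb, mul_div_assoc', Finset.mul_sum]
    simp only [hsum]
    rw [← Finset.sum_div, Finset.sum_comm, Finset.sum_congr rfl hblock, Finset.sum_const,
      card_inputs_eq, nsmul_eq_mul, mul_div_cancel_left₀ _ hcard']
  have hP := condProb_nonneg hW T i' 0
  have hQ := condProb_nonneg hW T i' 1
  have hN : Nonempty (Fin N) := ⟨i⟩
  -- For the weak inequality any multiplier serves; the position of its zero is irrelevant.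
  obtain ⟨h₀, A₀, -, hA₀, hAi₀⟩ := H hN.some
  refine lt_of_le_of_ne ?_ fun heq => ?_
  · have := sum_sqrt_mul_le_of_kernel (hK0 h₀) (hK1 h₀) hP hQ
    simpa only [hKc h₀ A₀ hA₀ hAi₀] using this
  refine condProb_zero_ne_one hW hS hZ1 hT i' ?_
  refine eq_of_proportional_of_boxes
    {b | ∃ x : F, (x = 0 ∨ x = 1) ∧ ∃ u ∈ inputs i' x, b = fun k => {o | 0 < W ((u ᵥ* T) k) o}}
    ?_ ?_ ?_ (sum_condProb hW T i' 0) (sum_condProb hW T i' 1)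
  · intro y
    rw [condProb_ne_zero_iff hW, condProb_ne_zero_iff hW]
    constructor
    · rintro (⟨u, hu, hy⟩ | ⟨u, hu, hy⟩)
      · exact ⟨_, ⟨0, Or.inl rfl, u, hu, rfl⟩, hy⟩
      · exact ⟨_, ⟨1, Or.inr rfl, u, hu, rfl⟩, hy⟩
    · rintro ⟨_, ⟨x, rfl | rfl, u, hu, rfl⟩, hy⟩
      · exact Or.inl ⟨u, hu, hy⟩
      · exact Or.inr ⟨u, hu, hy⟩
  · rintro _ ⟨x, -, u, -, rfl⟩ _ ⟨x', -, u', -, rfl⟩ k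
    exact hS.exists_common_output hW hZ0 _ _
  · intro p y w hyw
    obtain ⟨h, A, hp, hA, hAi⟩ := H p
    -- Since `h p = 0`, the `p`-th output is resampled, and `y` and `w` differ only there.
    have hrow : ∀ y', K h y y' = K h w y' := by
      intro y'
      simp only [K]
      congr 1
      refine Finset.sum_congr rfl fun d _ => Finset.prod_congr rfl fun k _ => ?_
      by_cases hk : k = p
      · subst hk
        rw [hp]
        exact htc _ _ _ _
      · rw [hyw k hk]
    obtain ⟨y', hy'⟩ : ∃ y', 0 < K h y y' := by
      by_contra! hcon
      have := hK1 h y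
      rw [Finset.sum_eq_zero fun y' _ => le_antisymm (hcon y') (hK0 h y y')] at this
      exact zero_ne_one this
    refine mul_eq_mul_of_sum_sqrt_mul_eq (hK0 h) (hK1 h) hP hQ ?_ hy' (hrow y' ▸ hy')
    simpa only [hKc h A hA hAi] using heq

end Strict

/-! ### Kronecker products and digits -/

section Kronecker

open scoped Matrix

variable {F : Type*} [Field F] {l n : ℕ}

theorem coe_eq_sum_digits (k : Fin (l ^ n)) : (k : ℕ) = ∑ t, (digits k t : ℕ) * l ^ (t : ℕ) := by
  rw [← finFunctionFinEquiv_apply, digits, Equiv.apply_symm_apply]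

@[simp]
theorem digits_finFunctionFinEquiv (f : Fin n → Fin l) : digits (finFunctionFinEquiv f) = f := by
  simp [digits]

theorem digits_injective : Function.Injective (digits : Fin (l ^ n) → Fin n → Fin l) :=
  finFunctionFinEquiv.symm.injective

/-- Complementing every digit to `l - 1` complements the number to `l ^ n - 1`, by the geometric
sum. -/
theorem digits_rev (k : Fin (l ^ n)) (t : Fin n) : digits k.rev t = (digits k t).rev := by
  have hl : 0 < l := (digits k t).pos
  have h : k.rev = finFunctionFinEquiv fun t => (digits k t).rev := by
    apply Fin.ext
    have h1 : ((finFunctionFinEquiv fun t => (digits k t).rev : Fin (l ^ n)) : ℕ) + k + 1 = l ^ n := by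
      rw [coe_eq_sum_digits k, finFunctionFinEquiv_apply, ← Finset.sum_add_distrib]
      have : ∀ t, ((digits k t).rev : ℕ) * l ^ (t : ℕ) + (digits k t : ℕ) * l ^ (t : ℕ) =
          l ^ (t : ℕ) * (l - 1) := by
        intro t
        rw [← add_mul, mul_comm, Fin.val_rev]
        congr 1
        have := (digits k t).isLt
        omega
      simp only [this]
      rw [Fin.sum_univ_eq_sum_range (fun t => l ^ t * (l - 1)), ← Finset.sum_mul]
      have := geom_sum_mul_add (l - 1) n
      rwa [Nat.sub_add_cancel (show 1 ≤ l from hl)] at this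
    rw [Fin.val_rev]
    omega
  rw [h, digits_finFunctionFinEquiv]

theorem digitReverse_digitReverse (k : Fin (l ^ n)) : digitReverse (digitReverse k) = k := by
  apply digits_injective
  funext t
  simp [digitReverse]

/-- The Kronecker product of a family of matrices, indexed by the `l`-ary digits. -/
def kroneckerProd (A : Fin n → Matrix (Fin l) (Fin l) F) : Matrix (Fin (l ^ n)) (Fin (l ^ n)) F :=
  Matrix.of fun i j => ∏ t, A t (digits i t) (digits j t)

theorem kroneckerProd_mul (A B : Fin n → Matrix (Fin l) (Fin l) F) :
    kroneckerProd A * kroneckerProd B = kroneckerProd fun t => A t * B t := by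
  ext i j
  simp only [kroneckerProd, Matrix.mul_apply, Matrix.of_apply, ← Finset.prod_mul_distrib]
  rw [← Equiv.sum_comp finFunctionFinEquiv]
  simp only [digits_finFunctionFinEquiv]
  exact sum_prod_eq_prod_sum fun t s => A t (digits i t) s * B t s (digits j t)

theorem kroneckerProd_one : kroneckerProd (fun _ : Fin n => (1 : Matrix (Fin l) (Fin l) F)) = 1 := by
  ext i j
  simp only [kroneckerProd, Matrix.of_apply, Matrix.one_apply]
  rw [Fintype.prod_ite_zero]
  simp only [Finset.prod_const_one, ← funext_iff, digits_injective.eq_iff]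

/-- Reordering the factors moves the digit reversal from the rows to the columns. The rows then
carry their ordinary digits, which are compatible with the order in which inputs are decoded. -/
theorem polarMatrix_eq (G : Matrix (Fin l) (Fin l) F) (n : ℕ) :
    polarMatrix G n = (kroneckerProd fun _ : Fin n => G).submatrix id digitReverse := by
  ext i j
  simp only [polarMatrix, kroneckerPow, kroneckerProd, Matrix.submatrix_apply, Matrix.of_apply, id]
  rw [← Equiv.prod_comp Fin.revPerm]
  simp [digitReverse]

theorem isUnit_det_polarMatrix {G : Matrix (Fin l) (Fin l) F} (hG : IsUnit G.det) (n : ℕ) :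
    IsUnit (polarMatrix G n).det := by
  apply Matrix.isUnit_det_of_right_inverse
    (B := (kroneckerProd fun _ : Fin n => G⁻¹).submatrix digitReverse id)
  let e : Equiv.Perm (Fin (l ^ n)) :=
    ⟨digitReverse, digitReverse, digitReverse_digitReverse, digitReverse_digitReverse⟩
  have h := Matrix.submatrix_mul_equiv (kroneckerProd fun _ : Fin n => G)
    (kroneckerProd fun _ : Fin n => G⁻¹) id e id
  rw [polarMatrix_eq]
  refine h.trans ?_
  simp only [kroneckerProd_mul, Matrix.mul_nonsing_inv _ hG, kroneckerProd_one,
    Matrix.submatrix_id_id]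

/-- For every column `a` there is a vector vanishing at `a`, multiplication by which maps each row
to a nonzero multiple of the preceding row plus a combination of later rows. -/
def HasMultipliers (G : Matrix (Fin l) (Fin l) F) : Prop :=
  ∀ a, ∃ (h : Fin l → F) (B : Matrix (Fin l) (Fin l) F), h a = 0 ∧
    B * G = G * Matrix.diagonal h ∧ (∀ r s : Fin l, (s : ℕ) + 1 < r → B r s = 0) ∧
    ∀ r s : Fin l, (s : ℕ) + 1 = r → B r s ≠ 0

variable {O : Type*} [Fintype F] [Fintype O] {W : F → O → ℝ}

theorem bhattacharyya_polarMatrix_lt_of_digit (hW : IsChannel W) (hS : IsSOF W)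
    (hZ0 : 0 < bhattacharyya W) (hZ1 : bhattacharyya W < 1) {G : Matrix (Fin l) (Fin l) F}
    (hG : IsUnit G.det) (hM : HasMultipliers G) {i i' : Fin (l ^ n)} {t : Fin n}
    (ht : (digits i t : ℕ) + 1 = digits i' t) (htt : ∀ τ ≠ t, digits i τ = digits i' τ) :
    bhattacharyya (splitChannel W (polarMatrix G n) i') <
      bhattacharyya (splitChannel W (polarMatrix G n) i) := by
  refine bhattacharyya_splitChannel_lt hW hS hZ0 hZ1 (isUnit_det_polarMatrix hG n) fun p => ?_
  -- The row digit `t` is paired with the column digit `t.rev`, so the multiplier must vanish at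
  -- that digit of `p`.
  obtain ⟨h, B, hp, hB, hB0, hB1⟩ := hM (digits p t.rev)
  set A : Matrix (Fin (l ^ n)) (Fin (l ^ n)) F :=
    kroneckerProd fun τ => if τ = t then B else 1 with hA
  -- `A` moves a row up by at most `l ^ t`, the exact distance from `i'` to `i`. Inputs supported
  -- from `i'` on thus go to inputs supported from `i` on.
  have hval : ∀ r s, A r s ≠ 0 → (r : ℕ) ≤ s + l ^ (t : ℕ) := by
    intro r s hrs
    rw [hA, kroneckerProd, Matrix.of_apply, Finset.prod_ne_zero_iff] at hrs
    rw [coe_eq_sum_digits r, coe_eq_sum_digits s, show l ^ (t : ℕ) =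
      ∑ τ : Fin n, if τ = t then l ^ (τ : ℕ) else 0 by simp, ← Finset.sum_add_distrib]
    refine Finset.sum_le_sum fun τ _ => ?_
    have hτ := hrs τ (Finset.mem_univ _)
    split_ifs at hτ ⊢ with h1
    · have : (digits r τ : ℕ) ≤ digits s τ + 1 := by
        by_contra! hcon
        exact hτ (hB0 _ _ hcon)
      calc (digits r τ : ℕ) * l ^ (τ : ℕ) ≤ (digits s τ + 1) * l ^ (τ : ℕ) :=
            Nat.mul_le_mul_right _ this
        _ = _ := by ring
    · have : digits r τ = digits s τ := by
        by_contra hcon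
        exact hτ (Matrix.one_apply_ne hcon)
      simp [this]
  have hii : (i' : ℕ) = i + l ^ (t : ℕ) := by
    rw [coe_eq_sum_digits i', coe_eq_sum_digits i, show l ^ (t : ℕ) =
      ∑ τ : Fin n, if τ = t then l ^ (τ : ℕ) else 0 by simp, ← Finset.sum_add_distrib]
    refine Finset.sum_congr rfl fun τ _ => ?_
    split_ifs with h1
    · rw [h1, ← ht]; ring
    · rw [htt τ h1, add_zero]
  have hc : A i' i ≠ 0 := by
    rw [hA, kroneckerProd, Matrix.of_apply, Finset.prod_ne_zero_iff]
    intro τ _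
    split_ifs with h1
    · subst h1
      exact hB1 _ _ ht
    · rw [htt τ h1, Matrix.one_apply_eq]
      exact one_ne_zero
  have hAT : A * polarMatrix G n =
      polarMatrix G n * Matrix.diagonal fun c => h (digits c t.rev) := by
    ext r c
    have h1 : (A * polarMatrix G n) r c =
        (A * (kroneckerProd fun _ : Fin n => G)) r (digitReverse c) := by
      rw [polarMatrix_eq]
      rfl
    rw [h1, hA, kroneckerProd_mul, Matrix.mul_diagonal, polarMatrix_eq]
    simp only [kroneckerProd, Matrix.of_apply, Matrix.submatrix_apply, id]
    have h2 : h (digits c t.rev) = ∏ τ : Fin n, if τ = t then h (digits c τ.rev) else 1 := by simp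
    rw [h2, ← Finset.prod_mul_distrib]
    refine Finset.prod_congr rfl fun τ _ => ?_
    split_ifs with h3
    · rw [hB, Matrix.mul_diagonal]
      simp [digitReverse]
    · simp
  -- The scaling makes the `i`-th entry of the image equal to the `i'`-th entry of `u`.
  refine ⟨fun c => (A i' i)⁻¹ * h (digits c t.rev), (A i' i)⁻¹ • A, by simp [hp], ?_, ?_⟩
  · rw [Matrix.smul_mul, hAT, ← Matrix.mul_smul, ← Matrix.diagonal_smul]
    rfl
  · intro x u hu
    rw [mem_inputs] at hu ⊢
    have hle : ∀ r, u r ≠ 0 → i' ≤ r := fun r hr => not_lt.1 fun hlt => hr (hu.2 r hlt)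
    have hsum : ∀ j, (u ᵥ* ((A i' i)⁻¹ • A)) j = (A i' i)⁻¹ * ∑ r, u r * A r j := by
      intro j
      rw [Matrix.vecMul_smul]
      rfl
    simp only [hsum]
    constructor
    · rw [Finset.sum_eq_single i', hu.1, mul_comm x, ← mul_assoc, inv_mul_cancel₀ hc, one_mul]
      · intro r _ hr
        by_contra hcon
        have h1 := hval r i (right_ne_zero_of_mul hcon)
        have h2 := hle r (left_ne_zero_of_mul hcon)
        rw [← hii] at h1
        exact hr (le_antisymm h1 h2)
      · simp
    · intro j hj
      rw [Finset.sum_eq_zero, mul_zero]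
      intro r _
      by_contra hcon
      have h1 := hval r j (right_ne_zero_of_mul hcon)
      have h2 : (i' : ℕ) ≤ r := hle r (left_ne_zero_of_mul hcon)
      have h3 : (j : ℕ) < i := hj
      omega

theorem bhattacharyya_polarMatrix_lt (hW : IsChannel W) (hS : IsSOF W)
    (hZ0 : 0 < bhattacharyya W) (hZ1 : bhattacharyya W < 1) {G : Matrix (Fin l) (Fin l) F}
    (hG : IsUnit G.det) (hM : HasMultipliers G) {i i' : Fin (l ^ n)} (hne : i ≠ i')
    (hle : ∀ t, digits i t ≤ digits i' t) :
    bhattacharyya (splitChannel W (polarMatrix G n) i') <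
      bhattacharyya (splitChannel W (polarMatrix G n) i) := by
  -- Descend from `i'` to `i` by lowering one digit by one at a time.
  induction hs : ∑ t, (digits i' t : ℕ) generalizing i' with
  | zero =>
    refine absurd (digits_injective (funext fun t => ?_)) hne
    have h1 := Finset.sum_eq_zero_iff.1 hs t (Finset.mem_univ _)
    have h2 : (digits i t : ℕ) ≤ digits i' t := hle t
    exact Fin.ext (by omega)
  | succ m ih =>
    obtain ⟨t, ht⟩ : ∃ t, digits i t < digits i' t := by
      by_contra! hcon
      exact hne (digits_injective (funext fun t => le_antisymm (hle t) (hcon t)))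
    have htv : (digits i t : ℕ) < digits i' t := ht
    let d : Fin n → Fin l :=
      Function.update (digits i') t ⟨(digits i' t : ℕ) - 1, by have := (digits i' t).isLt; omega⟩
    have hdt : ((d t : Fin l) : ℕ) + 1 = digits i' t := by simp [d]; omega
    have hdτ : ∀ τ ≠ t, d τ = digits i' τ := fun τ hτ => by simp [d, hτ]
    have step := bhattacharyya_polarMatrix_lt_of_digit hW hS hZ0 hZ1 hG hM
      (i := finFunctionFinEquiv d) (i' := i') (t := t) (by simpa using hdt) (by simpa using hdτ)
    by_cases heq : i = finFunctionFinEquiv d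
    · rwa [← heq] at step
    · refine step.trans (ih heq ?_ ?_)
      · intro τ
        rw [digits_finFunctionFinEquiv]
        by_cases hτ : τ = t
        · subst hτ
          rw [Fin.le_def]; omega
        · rw [hdτ τ hτ]; exact hle τ
      · rw [digits_finFunctionFinEquiv]
        rw [← Finset.add_sum_erase _ _ (Finset.mem_univ t)] at hs ⊢
        rw [Finset.sum_congr rfl fun τ hτ => by rw [hdτ τ (Finset.ne_of_mem_erase hτ)]]
        omega

theorem IsPolarCode.isWeaklyDecreasing (hW : IsChannel W) (hS : IsSOF W)
    (hZ0 : 0 < bhattacharyya W) (hZ1 : bhattacharyya W < 1) {G : Matrix (Fin l) (Fin l) F}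
    (hG : IsUnit G.det) (hM : HasMultipliers G) {A : Set (Fin (l ^ n))}
    (hA : IsPolarCode W G n A) : IsWeaklyDecreasing A := by
  intro k hk j hjk
  by_contra hj
  refine (hA k hk j hj).not_gt (bhattacharyya_polarMatrix_lt hW hS hZ0 hZ1 hG hM ?_ fun t => ?_)
  · intro h
    exact hj (Fin.rev_injective h ▸ hk)
  · rw [digits_rev, digits_rev]
    exact Fin.rev_le_rev.2 (hjk t)

end Kronecker

/-! ### Places of a rational function field -/

section Places

open Polynomial IsDedekindDomain

variable {F K : Type*} [Field F] [Field K] [Algebra F K]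

namespace Place

theorem mem_ring_iff (P : Place F K) (f : K) : f ∈ P.ring ↔ P.val f ≤ 1 := by
  let := P.isDVR
  constructor
  · intro h
    exact (IsDiscreteValuationRing.maximalIdeal P.ring).valuation_le_one (⟨f, h⟩ : P.ring)
  · intro h
    obtain ⟨a, rfl⟩ := IsDiscreteValuationRing.exists_lift_of_le_one h
    exact a.2

theorem exists_val_eq_exp (P : Place F K) : ∃ f : K, P.val f = WithZero.exp (-1 : ℤ) := by
  let := P.isDVR
  exact (IsDiscreteValuationRing.maximalIdeal P.ring).valuation_exists_uniformizer K

theorem eq_of_val_eq {P P' : Place F K} (h : ∀ f, P.val f = P'.val f) : P = P' := by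
  ext f
  rw [mem_ring_iff, mem_ring_iff, h]

theorem val_const_le (P : Place F K) (c : F) : P.val (algebraMap F K c) ≤ 1 :=
  (P.mem_ring_iff _).1 (P.const_mem c)

theorem val_const (P : Place F K) {c : F} (hc : c ≠ 0) : P.val (algebraMap F K c) = 1 := by
  refine le_antisymm (P.val_const_le c) ?_
  have h := P.val_const_le c⁻¹
  rw [map_inv₀, map_inv₀] at h
  have h0 : 0 < P.val (algebraMap F K c) := by
    rw [zero_lt_iff, Valuation.ne_zero_iff]
    simpa using hc
  exact (inv_le_one₀ h0).1 h

theorem eval_eq (P : Place F K) {f : K} {c : F} (h : P.val (f - algebraMap F K c) < 1) :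
    P.eval f = c := by
  have hex : ∃ c : F, P.val (f - algebraMap F K c) < 1 := ⟨c, h⟩
  rw [eval, dif_pos hex]
  by_contra hne
  have h1 := P.val_const (sub_ne_zero.2 hne)
  have h2 : algebraMap F K (hex.choose - c) =
      (f - algebraMap F K c) - (f - algebraMap F K hex.choose) := by
    rw [map_sub]; ring
  rw [h2] at h1
  exact (Valuation.map_sub_lt _ h hex.choose_spec).ne h1

theorem val_aeval_le_one (P : Place F K) {x : K} (hx : P.val x ≤ 1) (p : F[X]) :
    P.val (aeval x p) ≤ 1 := by
  rw [aeval_eq_sum_range]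
  refine Valuation.map_sum_le _ fun i _ => ?_
  rw [Algebra.smul_def, map_mul, map_pow]
  exact mul_le_one' (P.val_const_le _) (pow_le_one' hx i)

theorem eval_aeval (P : Place F K) {x : K} {a : F} (hx : P.val (x - algebraMap F K a) < 1)
    (p : F[X]) : P.eval (aeval x p) = p.eval a := by
  refine P.eval_eq ?_
  have hx1 : P.val x ≤ 1 := by
    have := Valuation.map_add P.val (x - algebraMap F K a) (algebraMap F K a)
    rw [sub_add_cancel] at this
    exact this.trans (max_le hx.le (P.val_const_le a))
  obtain ⟨r, hr⟩ := X_sub_C_dvd_sub_C_eval (p := p) (a := a)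
  have h : aeval x p - algebraMap F K (p.eval a) = (x - algebraMap F K a) * aeval x r := by
    have := congrArg (aeval x) hr
    simpa using this
  rw [h, map_mul]
  exact mul_lt_one_of_lt_of_le hx (P.val_aeval_le_one hx1 r)

/-- At a pole of `x` the leading term strictly dominates, by the ultrametric inequality. -/
theorem val_aeval_of_one_lt (P : Place F K) {x : K} (hx : 1 < P.val x) {p : F[X]} (hp : p ≠ 0) :
    P.val (aeval x p) = P.val x ^ p.natDegree := by
  have hlead : P.val (p.coeff p.natDegree • x ^ p.natDegree) = P.val x ^ p.natDegree := by
    rw [Algebra.smul_def, map_mul, map_pow, coeff_natDegree,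
      P.val_const (leadingCoeff_ne_zero.2 hp), one_mul]
  have h0 : 0 < P.val x := zero_lt_one.trans hx
  rw [aeval_eq_sum_range, Finset.sum_range_succ, ← hlead]
  refine Valuation.map_add_eq_of_lt_right _ ?_
  rw [hlead]
  refine Valuation.map_sum_lt _ (pow_pos h0 _).ne' fun i hi => ?_
  rw [Algebra.smul_def, map_mul, map_pow]
  exact (mul_le_of_le_one_left' (P.val_const_le _)).trans_lt
    (pow_lt_pow_right₀ hx (Finset.mem_range.1 hi))

end Place

/-- The function `x` generates the function field and is transcendental over the constants. -/
def IsCoordinate (F : Type*) {K : Type*} [Field F] [Field K] [Algebra F K] (x : K) : Prop :=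
  Transcendental F x ∧ IntermediateField.adjoin F {x} = ⊤

/-! ### Poles, zeros and regular functions of a coordinate -/

namespace IsCoordinate

variable {x : K}

theorem aeval_injective (hx : IsCoordinate F x) : Function.Injective (aeval x : F[X] →ₐ[F] K) :=
  transcendental_iff_injective.1 hx.1

theorem exists_eq_div (hx : IsCoordinate F x) (f : K) :
    ∃ p q : F[X], q ≠ 0 ∧ f = aeval x p / aeval x q := by
  obtain ⟨p, q, h⟩ := (IntermediateField.mem_adjoin_simple_iff F f).1
    (hx.2 ▸ IntermediateField.mem_top (F := F) (E := K) (x := f))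
  -- Division by zero gives `f = 0` here, which is rewritten with denominator 1.
  by_cases hq : q = 0
  · exact ⟨0, 1, one_ne_zero, by simp [h, hq]⟩
  · exact ⟨p, q, hq, h⟩

theorem ne_const (hx : IsCoordinate F x) (c : F) : x - algebraMap F K c ≠ 0 := by
  intro h
  exact hx.1 (sub_eq_zero.1 h ▸ isAlgebraic_algebraMap c)

theorem inv_sub (hx : IsCoordinate F x) (c : F) : IsCoordinate F (x - algebraMap F K c)⁻¹ := by
  have hxy : x = ((x - algebraMap F K c)⁻¹)⁻¹ + algebraMap F K c := by simp
  constructor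
  · intro h
    apply hx.1
    rw [hxy]
    exact h.inv.add (isAlgebraic_algebraMap c)
  · rw [eq_top_iff, ← hx.2, IntermediateField.adjoin_simple_le_iff]
    have := IntermediateField.mem_adjoin_simple_self F (x - algebraMap F K c)⁻¹
    have hmem := add_mem (inv_mem this) (IntermediateField.algebraMap_mem _ c)
    rwa [← hxy] at hmem

/-- Nonzero functions are quotients of polynomials in `x`, so their orders at the pole are multiples
of that of `x`; a uniformizer forces this order to be 1. -/
theorem val_eq_exp (hx : IsCoordinate F x) {P : Place F K} (hP : 1 < P.val x) :
    P.val x = WithZero.exp (1 : ℤ) := by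
  obtain ⟨f, hf⟩ := P.exists_val_eq_exp
  obtain ⟨p, q, hq, rfl⟩ := hx.exists_eq_div f
  have hp : p ≠ 0 := by
    rintro rfl
    rw [map_zero, zero_div, map_zero] at hf
    exact WithZero.exp_ne_zero hf.symm
  rw [map_div₀, P.val_aeval_of_one_lt hP hp, P.val_aeval_of_one_lt hP hq] at hf
  have h0 : P.val x ≠ 0 := (zero_lt_one.trans hP).ne'
  rw [← WithZero.exp_log h0] at hf hP ⊢
  set e := WithZero.log (P.val x)
  rw [← WithZero.exp_nsmul, ← WithZero.exp_nsmul, ← WithZero.exp_sub, WithZero.exp_inj] at hf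
  rw [← WithZero.exp_zero, WithZero.exp_lt_exp] at hP
  have hdvd : e ∣ 1 := ⟨q.natDegree - p.natDegree, by simp only [nsmul_eq_mul] at hf; linarith⟩
  rw [Int.eq_one_of_dvd_one hP.le hdvd]

theorem eq_of_one_lt (hx : IsCoordinate F x) {P P' : Place F K} (hP : 1 < P.val x)
    (hP' : 1 < P'.val x) : P = P' := by
  refine Place.eq_of_val_eq fun f => ?_
  obtain ⟨p, q, hq, rfl⟩ := hx.exists_eq_div f
  by_cases hp : p = 0
  · simp [hp]
  · rw [map_div₀, map_div₀, P.val_aeval_of_one_lt hP hp, P.val_aeval_of_one_lt hP hq,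
      P'.val_aeval_of_one_lt hP' hp, P'.val_aeval_of_one_lt hP' hq, hx.val_eq_exp hP,
      hx.val_eq_exp hP']

theorem one_lt_val_inv_sub (hx : IsCoordinate F x) {P : Place F K} {a : F}
    (hP : P.val (x - algebraMap F K a) < 1) : 1 < P.val (x - algebraMap F K a)⁻¹ := by
  rw [map_inv₀]
  refine (one_lt_inv₀ ?_).2 hP
  rw [zero_lt_iff, Valuation.ne_zero_iff]
  exact hx.ne_const a

/-- A zero of `x - a` is a pole of the coordinate `(x - a)⁻¹`, and a coordinate has at most one
pole. -/
theorem eq_of_val_sub_lt_one (hx : IsCoordinate F x) {P P' : Place F K} {a : F}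
    (hP : P.val (x - algebraMap F K a) < 1) (hP' : P'.val (x - algebraMap F K a) < 1) : P = P' :=
  (hx.inv_sub a).eq_of_one_lt (hx.one_lt_val_inv_sub hP) (hx.one_lt_val_inv_sub hP')

/-- `K` is the fraction field of the Dedekind domain `F[x]`, which is the intersection of its
localizations at nonzero primes. Each such prime gives a place at which `x` is regular. -/
theorem mem_range_aeval (hx : IsCoordinate F x) {f : K}
    (hf : ∀ P : Place F K, P.val x ≤ 1 → P.val f ≤ 1) : ∃ p : F[X], f = aeval x p := by
  let : Algebra F[X] K := (aeval x : F[X] →ₐ[F] K).toRingHom.toAlgebra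
  have hmap : ∀ p : F[X], algebraMap F[X] K p = aeval x p := fun p => rfl
  have : FaithfulSMul F[X] K := (faithfulSMul_iff_algebraMap_injective F[X] K).2 hx.aeval_injective
  have : IsFractionRing F[X] K := IsFractionRing.of_field F[X] K fun z => by
    obtain ⟨p, q, -, h⟩ := hx.exists_eq_div z
    exact ⟨p, q, h⟩
  have hmem : f ∈ (algebraMap F[X] K).range := by
    refine HeightOneSpectrum.mem_integers_of_valuation_le_one K f fun v => ?_
    let P : Place F K :=
      { ring := (v.valuation K).valuationSubring
        const_mem := fun c => by
          have h : algebraMap F K c = algebraMap F[X] K (C c) := by rw [hmap, aeval_C]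
          rw [h]
          exact v.valuation_le_one (K := K) (C c)
        isDVR := (v.valuation K).valuationSubring_isDiscreteValuationRing }
    refine (P.mem_ring_iff f).2 (hf P ((P.mem_ring_iff x).1 ?_))
    have h : x = algebraMap F[X] K X := by rw [hmap, aeval_X]
    rw [h]
    exact v.valuation_le_one (K := K) X
  obtain ⟨p, hp⟩ := hmem
  exact ⟨p, hp.symm⟩

/-- The degree of a polynomial is its pole order at `Q`. The form `n - 1` includes the divisor `-Q`,
needed for `m = 0` in `Hstar`. -/
theorem rrSpace_eq (hx : IsCoordinate F x) {Q : Place F K} (hQ : 1 < Q.val x) (n : ℕ) :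
    rrSpace (Finsupp.single Q ((n : ℤ) - 1)) = aeval x '' {p : F[X] | p.degree < n} := by
  classical
  have hexp : ∀ p : F[X], p ≠ 0 → Q.val (aeval x p) = WithZero.exp (p.natDegree : ℤ) := by
    intro p hp
    rw [Q.val_aeval_of_one_lt hQ hp, hx.val_eq_exp hQ, ← WithZero.exp_nsmul]
    simp
  have hdeg : ∀ p : F[X], p ≠ 0 → (Q.val (aeval x p) ≤ WithZero.exp ((n : ℤ) - 1) ↔
      p.degree < n) := by
    intro p hp
    rw [hexp p hp, WithZero.exp_le_exp, degree_eq_natDegree hp, Nat.cast_lt]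
    omega
  ext f
  simp only [rrSpace, Set.mem_ofPred_eq, Set.mem_image]
  constructor
  · intro hf
    obtain ⟨p, rfl⟩ := hx.mem_range_aeval (f := f) fun P hP => by
      have hPQ : Q ≠ P := fun h => hQ.not_ge (h ▸ hP)
      simpa [Finsupp.single_apply, hPQ] using hf P
    refine ⟨p, ?_, rfl⟩
    by_cases hp : p = 0
    · simp [hp]
    · exact (hdeg p hp).1 (by simpa using hf Q)
  · rintro ⟨p, hp, rfl⟩ P
    by_cases hp0 : p = 0
    · simp [hp0]
    by_cases hPQ : Q = P
    · subst hPQ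
      simpa using (hdeg p hp0).2 hp
    · have : P.val x ≤ 1 := not_lt.1 fun h => hPQ (hx.eq_of_one_lt hQ h)
      simpa [Finsupp.single_apply, hPQ] using P.val_aeval_le_one this p

end IsCoordinate

theorem IsRationalCurve.exists_isCoordinate (hK : IsRationalCurve F K) :
    ∃ x : K, IsCoordinate F x := by
  obtain ⟨e⟩ := hK
  refine ⟨e.symm RatFunc.X, ?_, ?_⟩
  · intro h
    exact RatFunc.transcendental_X ((isAlgebraic_algHom_iff e.symm.toAlgHom e.symm.injective).1 h)
  · have := congrArg (IntermediateField.map e.symm.toAlgHom) (RatFunc.adjoin_X (K := F))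
    rw [IntermediateField.adjoin_map, Set.image_singleton] at this
    refine this.trans ?_
    rw [← AlgHom.fieldRange_eq_map, AlgHom.fieldRange_eq_top]
    exact e.symm.surjective

theorem IsRationalCurve.exists_isCoordinate_one_lt (hK : IsRationalCurve F K) {Q : Place F K}
    (hQ : Q.IsRational) : ∃ x : K, IsCoordinate F x ∧ 1 < Q.val x := by
  obtain ⟨x, hx⟩ := hK.exists_isCoordinate
  by_cases h : 1 < Q.val x
  · exact ⟨x, hx, h⟩
  · obtain ⟨c, hc⟩ := hQ x ((Q.mem_ring_iff x).2 (not_lt.1 h))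
    exact ⟨_, hx.inv_sub c, hx.one_lt_val_inv_sub hc⟩

/-- On a rational curve the Riemann-Roch spaces of multiples of a rational point are spaces of
polynomials in a coordinate, and evaluation at the other rational points is evaluation of
polynomials at distinct constants. -/
theorem IsRationalCurve.exists_coordinate (hK : IsRationalCurve F K) {Q : Place F K}
    (hQ : Q.IsRational) {l : ℕ} {P : Fin l → Place F K} (hP : ∀ i, (P i).IsRational)
    (hinj : Function.Injective P) (hPQ : ∀ i, P i ≠ Q) :
    ∃ (x : K) (a : Fin l → F), Function.Injective (aeval x : F[X] →ₐ[F] K) ∧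
      Function.Injective a ∧
      (∀ n : ℕ, rrSpace (Finsupp.single Q ((n : ℤ) - 1)) = aeval x '' {p : F[X] | p.degree < n}) ∧
      ∀ i (p : F[X]), (P i).eval (aeval x p) = p.eval (a i) := by
  obtain ⟨x, hx, hQx⟩ := hK.exists_isCoordinate_one_lt hQ
  have hPx : ∀ i, (P i).val x ≤ 1 := fun i => not_lt.1 fun h => hPQ i (hx.eq_of_one_lt h hQx)
  choose a ha using fun i => hP i x (((P i).mem_ring_iff x).2 (hPx i))
  refine ⟨x, a, hx.aeval_injective, fun i j hij => hinj ?_, hx.rrSpace_eq hQx,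
    fun i p => (P i).eval_aeval (ha i) p⟩
  exact hx.eq_of_val_sub_lt_one (ha i) (hij ▸ ha j)

end Places

/-! ### Kernels of rational curves -/

section RationalKernel

open Polynomial
open scoped Matrix

variable {F K : Type*} [Field F] [Field K] [Algebra F K] {l : ℕ}

theorem exists_eval_eq {a : Fin l → F} (ha : Function.Injective a) (v : Fin l → F) :
    ∃ p : F[X], p.degree < l ∧ ∀ i, p.eval (a i) = v i := by
  refine ⟨Lagrange.interpolate Finset.univ a v, ?_, fun i => ?_⟩
  · simpa using Lagrange.degree_interpolate_lt (s := Finset.univ) v ha.injOn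
  · exact Lagrange.eval_interpolate_at_node v ha.injOn (Finset.mem_univ i)

theorem evalCode_eq {P : Fin l → Place F K} {Q : Place F K} {x : K} {a : Fin l → F}
    (hL : ∀ n : ℕ, rrSpace (Finsupp.single Q ((n : ℤ) - 1)) = aeval x '' {p : F[X] | p.degree < n})
    (hev : ∀ i (p : F[X]), (P i).eval (aeval x p) = p.eval (a i)) (n : ℕ) :
    evalCode P (Finsupp.single Q ((n : ℤ) - 1)) =
      (fun (p : F[X]) i => p.eval (a i)) '' {p | p.degree < n} := by
  rw [evalCode, hL, Set.image_image]
  simp only [hev]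

/-- For `m ≥ l`, degree less than `m` already interpolates every word. For `m < l`, the word of `X ^
m` is new, since polynomials of degree less than `l` are determined by their values at the `l`
nodes. -/
theorem Hstar_eq {P : Fin l → Place F K} {Q : Place F K} {x : K} {a : Fin l → F}
    (ha : Function.Injective a)
    (hL : ∀ n : ℕ, rrSpace (Finsupp.single Q ((n : ℤ) - 1)) = aeval x '' {p : F[X] | p.degree < n})
    (hev : ∀ i (p : F[X]), (P i).eval (aeval x p) = p.eval (a i)) :
    Hstar P Q = {m | m < l} := by
  ext m
  have hm : (m : ℤ) = ((m + 1 : ℕ) : ℤ) - 1 := by push_cast; ring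
  simp only [Hstar, Set.mem_ofPred_eq]
  rw [hm, evalCode_eq hL hev (m + 1), ← hm, evalCode_eq hL hev m]
  constructor
  · intro h
    by_contra! hlm
    refine h (Set.Subset.antisymm ?_ ?_)
    · refine Set.image_mono fun p (hp : p.degree < m) => ?_
      exact lt_trans hp (by exact_mod_cast Nat.lt_succ_self m)
    · rintro _ ⟨p, -, rfl⟩
      obtain ⟨q, hq, hqe⟩ := exists_eval_eq ha fun i => p.eval (a i)
      exact ⟨q, hq.trans_le (by exact_mod_cast hlm), funext hqe⟩
  · intro hml heq
    have hX : (fun i => (X ^ m : F[X]).eval (a i)) ∈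
        (fun (p : F[X]) i => p.eval (a i)) '' {p | p.degree < m} := by
      rw [heq]
      refine ⟨X ^ m, ?_, rfl⟩
      rw [Set.mem_ofPred_eq, degree_X_pow]
      exact_mod_cast Nat.lt_succ_self m
    obtain ⟨q, hq, hqe⟩ := hX
    have hq : q.degree < m := hq
    have hml' : (m : WithBot ℕ) < l := by exact_mod_cast hml
    have : q = X ^ m := by
      refine eq_of_degrees_lt_of_eval_index_eq Finset.univ ha.injOn ?_ ?_
        fun i _ => congrFun hqe i
      · simpa using hq.trans hml'
      · simpa using hml'
    rw [this, degree_X_pow] at hq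
    exact lt_irrefl _ hq

/-- The functions defining a kernel are polynomials of degrees `0, …, l - 1` in a coordinate. -/
theorem isKernelBasis_iff {P : Fin l → Place F K} {Q : Place F K} {x : K} {a : Fin l → F}
    (hx : Function.Injective (aeval x : F[X] →ₐ[F] K)) (ha : Function.Injective a)
    (hL : ∀ n : ℕ, rrSpace (Finsupp.single Q ((n : ℤ) - 1)) = aeval x '' {p : F[X] | p.degree < n})
    (hev : ∀ i (p : F[X]), (P i).eval (aeval x p) = p.eval (a i)) (M : Fin l → K) :
    IsKernelBasis P Q M ↔
      ∃ p : Fin l → F[X], (∀ k, (p k).degree = (k : ℕ)) ∧ ∀ k, M k = aeval x (p k) := by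
  have hsucc : ∀ n : ℕ, rrSpace (Finsupp.single Q (n : ℤ)) =
      aeval x '' {p : F[X] | p.degree < (n + 1 : ℕ)} := by
    intro n
    rw [← hL]
    push_cast
    rw [add_sub_cancel_right]
  have hrange : Set.range (Fin.val : Fin l → ℕ) = {m | m < l} := by
    ext m
    exact ⟨fun ⟨k, hk⟩ => hk ▸ k.isLt, fun hm => ⟨⟨m, hm⟩, rfl⟩⟩
  have hdeg : ∀ (p : F[X]) (n : ℕ), p.degree = n ↔ p.degree < (n + 1 : ℕ) ∧ ¬p.degree < n := by
    intro p n
    rw [not_lt]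
    constructor
    · intro h
      rw [h]
      exact ⟨by exact_mod_cast Nat.lt_succ_self n, le_rfl⟩
    · rintro ⟨h1, h2⟩
      have h1 : p.degree < ((n + 1 : ℕ) : WithBot ℕ) := h1
      refine le_antisymm ?_ h2
      by_cases hp : p = 0
      · simp [hp]
      · rw [degree_eq_natDegree hp] at h1 ⊢
        exact_mod_cast Nat.lt_succ_iff.1 (by exact_mod_cast h1)
  have hM : ∀ (f : K) (n : ℕ), (f ∈ rrSpace (Finsupp.single Q (n : ℤ)) ∧
      f ∉ rrSpace (Finsupp.single Q ((n : ℤ) - 1))) ↔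
        ∃ p : F[X], p.degree = n ∧ f = aeval x p := by
    intro f n
    rw [hsucc, hL]
    constructor
    · rintro ⟨⟨p, hp, rfl⟩, hn⟩
      exact ⟨p, (hdeg p n).2 ⟨hp, fun h => hn ⟨p, h, rfl⟩⟩, rfl⟩
    · rintro ⟨p, hp, rfl⟩
      refine ⟨⟨p, ((hdeg p n).1 hp).1, rfl⟩, ?_⟩
      rintro ⟨q, hq, hqp⟩
      exact ((hdeg p n).1 hp).2 (hx hqp ▸ hq)
  constructor
  · rintro ⟨m, hm, hmr, hMm⟩
    rw [Hstar_eq ha hL hev, ← hrange] at hmr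
    -- A strictly increasing enumeration is determined by its range, so `m k = k`.
    obtain rfl := (hm.range_inj Fin.val_strictMono).1 hmr
    choose p hp using fun k => (hM (M k) _).1 (hMm k)
    exact ⟨p, fun k => (hp k).1, fun k => (hp k).2⟩
  · rintro ⟨p, hp, hMp⟩
    exact ⟨Fin.val, Fin.val_strictMono, by rw [Hstar_eq ha hL hev, hrange],
      fun k => (hM _ _).2 ⟨p k, hp k, hMp k⟩⟩

theorem exists_combination {p : Fin l → F[X]} (hp : ∀ k, (p k).degree = (k : ℕ)) (n : ℕ)
    (hn : n ≤ l) (r : F[X]) (hr : r.degree < n) :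
    ∃ c : Fin l → F, r = ∑ j, c j • p j ∧ ∀ j : Fin l, n ≤ j → c j = 0 := by
  induction n generalizing r with
  | zero =>
    have : r = 0 := by
      by_contra h
      rw [degree_eq_natDegree h] at hr
      exact absurd hr (by simp)
    exact ⟨0, by simp [this], fun _ _ => rfl⟩
  | succ n ih =>
    let k : Fin l := ⟨n, hn⟩
    have hk : (p k).degree = (n : ℕ) := hp k
    have hk0 : (p k).coeff n ≠ 0 := coeff_ne_zero_of_eq_degree hk
    obtain ⟨c, hc, hc0⟩ := ih (by omega) (r - (r.coeff n / (p k).coeff n) • p k) (by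
      rw [degree_lt_iff_coeff_zero] at hr ⊢
      intro m hm
      rw [coeff_sub, coeff_smul, smul_eq_mul]
      rcases hm.eq_or_lt with rfl | hm
      · rw [div_mul_cancel₀ _ hk0, sub_self]
      · have hkm : (p k).degree < m := hk ▸ by exact_mod_cast hm
        rw [hr m hm, coeff_eq_zero_of_degree_lt hkm, mul_zero, sub_zero])
    refine ⟨c + Pi.single k (r.coeff n / (p k).coeff n), ?_, fun j hj => ?_⟩
    · have hs : ∑ j, (Pi.single k (r.coeff n / (p k).coeff n) : Fin l → F) j • p j =
          (r.coeff n / (p k).coeff n) • p k := by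
        rw [Finset.sum_eq_single k (fun j _ hj => by simp [hj]) (by simp)]
        simp
      simp only [Pi.add_apply, add_smul, Finset.sum_add_distrib]
      rw [hs, ← hc, sub_add_cancel]
    · have hjk : j ≠ k := by
        rintro rfl
        simp [k] at hj
      simp [hc0 j (by omega), hjk]

theorem coeff_combination {p : Fin l → F[X]} (hp : ∀ k, (p k).degree = (k : ℕ)) {c : Fin l → F}
    {d : Fin l} (hc : ∀ j, d < j → c j = 0) :
    (∑ j, c j • p j).coeff d = c d * (p d).coeff d := by
  rw [finsetSum_coeff, Finset.sum_eq_single d]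
  · simp
  · intro j _ hj
    rcases hj.lt_or_gt with h | h
    · rw [coeff_smul, coeff_eq_zero_of_degree_lt (hp j ▸ by exact_mod_cast h), smul_zero]
    · simp [hc j h]
  · simp

variable {a : Fin l → F} {p : Fin l → F[X]} {G : Matrix (Fin l) (Fin l) F}

theorem vecMul_rev_eq_eval (hG : ∀ r i, G r i = (p r.rev).eval (a i)) (c : Fin l → F) (i : Fin l) :
    ((fun r => c r.rev) ᵥ* G) i = (∑ j, c j • p j).eval (a i) := by
  rw [eval_finsetSum, ← Equiv.sum_comp Fin.revPerm, Matrix.vecMul, dotProduct]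
  simp [hG]

theorem isUnit_det_of_degree (ha : Function.Injective a) (hp : ∀ k, (p k).degree = (k : ℕ))
    (hG : ∀ r i, G r i = (p r.rev).eval (a i)) : IsUnit G.det := by
  rw [← Matrix.isUnit_iff_isUnit_det, ← Matrix.vecMul_surjective_iff_isUnit]
  intro v
  obtain ⟨r, hr, hre⟩ := exists_eval_eq ha v
  obtain ⟨c, hc, -⟩ := exists_combination hp l le_rfl r hr
  exact ⟨fun r => c r.rev, funext fun i => (vecMul_rev_eq_eval hG c i).trans (by rw [← hc, hre])⟩

/-- The multiplier is `X - C (a α)`: it vanishes at column `α` and raises each degree by exactly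
one, and rows are listed by decreasing degree. -/
theorem hasMultipliers_of_degree (ha : Function.Injective a) (hp : ∀ k, (p k).degree = (k : ℕ))
    (hG : ∀ r i, G r i = (p r.rev).eval (a i)) : HasMultipliers G := by
  intro α
  have key : ∀ k : Fin l, ∃ c : Fin l → F,
      (∀ i, (∑ j, c j • p j).eval (a i) = (a i - a α) * (p k).eval (a i)) ∧
      (∀ j : Fin l, (k : ℕ) + 1 < j → c j = 0) ∧ ∀ j : Fin l, (k : ℕ) + 1 = j → c j ≠ 0 := by
    intro k
    by_cases hk : (k : ℕ) + 1 < l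
    · have hdeg : ((X - C (a α)) * p k).degree = (((k : ℕ) + 1 : ℕ) : WithBot ℕ) := by
        rw [degree_mul, degree_X_sub_C, hp, add_comm]
        rfl
      obtain ⟨c, hc, hc0⟩ := exists_combination hp ((k : ℕ) + 2) hk ((X - C (a α)) * p k)
        (hdeg ▸ by exact_mod_cast Nat.lt_succ_self _)
      refine ⟨c, fun i => by simp [← hc], fun j hj => hc0 j hj, fun j hj hcj => ?_⟩
      have h1 := coeff_combination hp (c := c) (d := j) fun j' hj' =>
        hc0 j' (by have : (j : ℕ) < j' := hj'; omega)
      rw [← hc, hcj, zero_mul, ← hj] at h1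
      exact coeff_ne_zero_of_eq_degree hdeg h1
    -- In top degree the product has degree `l` and is replaced by its interpolant; no row precedes
    -- this one, so the coefficients are unconstrained.
    · obtain ⟨r, hr, hre⟩ := exists_eval_eq ha fun i => (a i - a α) * (p k).eval (a i)
      obtain ⟨c, hc, -⟩ := exists_combination hp l le_rfl r hr
      exact ⟨c, fun i => by rw [← hc, hre], fun j hj => by omega, fun j hj => by omega⟩
  choose c hc hc0 hc1 using key
  refine ⟨fun i => a i - a α, Matrix.of fun r s => c r.rev s.rev, sub_self _, ?_, ?_, ?_⟩
  · ext r i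
    rw [Matrix.mul_diagonal, hG, mul_comm, ← hc, ← vecMul_rev_eq_eval hG]
    rfl
  · intro r s h
    exact hc0 _ _ (by rw [Fin.val_rev, Fin.val_rev]; omega)
  · intro r s h
    exact hc1 _ _ (by rw [Fin.val_rev, Fin.val_rev]; omega)

end RationalKernel

end PolarAG

end

theorem mainTheorem11 {F K : Type*} [Field F] [Fintype F] [Field K] [Algebra F K]
    (hK : PolarAG.IsRationalCurve F K)
    (Q : PolarAG.Place F K) (hQ : Q.IsRational)
    {l : ℕ} (P : Fin l → PolarAG.Place F K) (hP : ∀ i, (P i).IsRational)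
    (hinj : Function.Injective P) (hPQ : ∀ i, P i ≠ Q) :
    PolarAG.Hstar P Q = {m | m < l} ∧
    (∃ M : Fin l → K, PolarAG.IsKernelBasis P Q M) ∧
    ∀ M : Fin l → K, PolarAG.IsKernelBasis P Q M →
      IsUnit (PolarAG.kernelMatrix P M).det ∧
      ∀ (O : Type*) [Fintype O] (W : F → O → ℝ),
        PolarAG.IsChannel W → PolarAG.IsSOF W →
        0 < PolarAG.bhattacharyya W → PolarAG.bhattacharyya W < 1 →
        ∀ (n : ℕ) (A : Set (Fin (l ^ n))),
          PolarAG.IsPolarCode W (PolarAG.kernelMatrix P M) n A →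
          PolarAG.IsWeaklyDecreasing A := by
  obtain ⟨x, a, hx, ha, hL, hev⟩ := hK.exists_coordinate hQ hP hinj hPQ
  have hbasis := PolarAG.isKernelBasis_iff hx ha hL hev
  refine ⟨PolarAG.Hstar_eq ha hL hev, ⟨fun k => Polynomial.aeval x (Polynomial.X ^ (k : ℕ)),
    (hbasis _).2 ⟨_, fun k => Polynomial.degree_X_pow _, fun k => rfl⟩⟩, fun M hM => ?_⟩
  obtain ⟨p, hp, hMp⟩ := (hbasis M).1 hM
  have hG : ∀ r i, PolarAG.kernelMatrix P M r i = (p r.rev).eval (a i) := fun r i => by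
    rw [PolarAG.kernelMatrix, Matrix.of_apply, hMp, hev]
  have hdet := PolarAG.isUnit_det_of_degree ha hp hG
  exact ⟨hdet, fun O _ W hW hS hZ0 hZ1 n A hA =>
    hA.isWeaklyDecreasing hW hS hZ0 hZ1 hdet (PolarAG.hasMultipliers_of_degree ha hp hG)⟩
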